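/- Let $d, I\ge 0$ be integers and let $f_0,f_1,\dots,f_I:\mathbb R^d\to\overline{\mathbb R}=[-\infty,+\infty]$ be proper, closed and convex. (Here $f$ is proper if it nowhere equals $-\infty$ and is finite somewhere, closed if it is lower semicontinuous and either nowhere or everywhere equal to $-\infty$, and convex if its epigraph is convex.) Write $\operatorname{dom} f=\{x : f(x)<+\infty\}$, $f^*(w)=\sup_x\{x^\top w-f(x)\}$ for the conjugate, and $f^{**}=(f^*)^*$. Consider the primal problem $$\text{(P)}\qquad \inf_{x\in\mathbb R^d}\ f_0(x)\quad\text{s.t. } f_i(x)\le 0,\ i=1,\dots,I,$$ and the dual problem $$\text{(D)}\qquad \sup_{w_0,\dots,w_I\in\mathbb R^d,\ \lambda\in\mathbb R^I}\ -f_0^*(w_0)-\sum_{i=1}^I\lambda_i f_i^*(w_i/\lambda_i)\quad\text{s.t. } \sum_{i=0}^I w_i=0,\ \lambda\ge 0,$$ where $\lambda_i f_i^*(w_i/\lambda_i)$ denotes the convex perspective of $f_i^*$: for $\lambda_i=0$ it is understood as $\sup\{x^\top w_i : x\in\operatorname{dom} f_i^{**}\}$, and as $+\infty$ for $\lambda_i<0$.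 A feasible solution of a minimization (maximization) problem is a point that satisfies all constraints and whose objective value is not $+\infty$ ($-\infty$); the feasible region is the set of all feasible solutions. A problem is solvable if its optimal value is attained by a feasible solution or if it has no feasible solution (an infeasible problem is, by convention, solved by any point). The infimum over the empty set is $+\infty$ and the supremum over the empty set is $-\infty$. A Slater point of a problem with objective $g$, inequality constraints $g_i\le 0$ and equality constraints $h_j=0$ is a point $x$ that satisfies all constraints, lies in the relative interior of $\operatorname{dom} g_i$ and of $\operatorname{dom} h_j$ for all $i,j$ and in the relative interior of $\operatorname{dom} g$ (of $\operatorname{dom}(-g)$ for a maximization problem), and satisfies $g_i(x)<0$ for every $i$ for which $g_i$ is nonlinear, that is, not a real-valued affine function. Theorem (Strong Duality). The following statements hold. (i) If (P) admits a Slater point, then the infimum of (P) coincides with the supremum of (D), and (D) is solvable. If (D) admits a Slater point, then the infimum of (P) coincides with the supremum of (D), and (P) is solvable. (ii) If the feasible region of (P) is nonempty and bounded, then the infimum of (P) coincides with the supremum of (D), and (P) is solvable. If the feasible region of (D) is nonempty and bounded, then the infimum of (P) coincides with the supremum of (D), and (D) is solvable. -/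

import Mathlib

namespace ConvexDuality

noncomputable section

/-! Extended real-valued functions. -/

/-- The domain `{x | f x < +∞}`. -/
def dom {E : Type*} (f : E → EReal) : Set E := {x | f x < ⊤}

/-- The epigraph `{(x, τ) ∈ E × ℝ | f x ≤ τ}`. -/
def epi {E : Type*} (f : E → EReal) : Set (E × ℝ) := {p | f p.1 ≤ (p.2 : EReal)}

/-- `f` never takes the value `-∞` and is finite somewhere. -/
def IsProper {E : Type*} (f : E → EReal) : Prop :=
  (∀ x, ⊥ < f x) ∧ ∃ x, f x < ⊤

/-- `f` is lower semicontinuous, and either nowhere `-∞` or everywhere `-∞`. -/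
def IsClosedFun {E : Type*} [TopologicalSpace E] (f : E → EReal) : Prop :=
  LowerSemicontinuous f ∧ ((∀ x, ⊥ < f x) ∨ ∀ x, f x = ⊥)

/-- Convexity of an extended real-valued function: its epigraph is convex. -/
def IsConvexFun {E : Type*} [AddCommGroup E] [Module ℝ E] (f : E → EReal) : Prop :=
  Convex ℝ (epi f)

/-- `f` is a linear function in the sense of linear constraints: finite everywhere and affine. -/
def IsLinearFun {E : Type*} [AddCommGroup E] [Module ℝ E] (f : E → EReal) : Prop :=
  ∃ g : E →ᵃ[ℝ] ℝ, ∀ x, f x = ((g x : ℝ) : EReal)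

/-- The conjugate `f* w = sup_x {⟨x, w⟩ - f x}`. -/
def conj {E : Type*} [NormedAddCommGroup E] [InnerProductSpace ℝ E] (f : E → EReal) :
    E → EReal :=
  fun w => ⨆ x : E, ((inner ℝ x w : ℝ) : EReal) - f x

/-- The support function `w ↦ sup_{x ∈ S} ⟨x, w⟩`. -/
def supportFun {E : Type*} [NormedAddCommGroup E] [InnerProductSpace ℝ E] (S : Set E) :
    E → EReal :=
  fun w => ⨆ x ∈ S, ((inner ℝ x w : ℝ) : EReal)

/-- The convex perspective: `t f(x/t)` for `t > 0` and the support function of `dom f*` for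
`t = 0`; as a function on all of `E × ℝ` it is `+∞` outside its domain of definition `t ≥ 0`. -/
def perspective {E : Type*} [NormedAddCommGroup E] [InnerProductSpace ℝ E] (f : E → EReal)
    (x : E) (t : ℝ) : EReal :=
  if 0 < t then (t : EReal) * f (t⁻¹ • x)
  else if t = 0 then supportFun (dom (conj f)) x
  else ⊤

/-! Optimization problems. -/

/-- A representation of a set by constraints `ineqFun i x ≤ 0` and `eqFun j x = 0`. -/
structure ConstraintSystem (E ι κ : Type*) where
  ineqFun : ι → E → EReal
  eqFun : κ → E → EReal

/-- The set represented by a constraint system. -/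
def ConstraintSystem.carrier {E ι κ : Type*} (C : ConstraintSystem E ι κ) : Set E :=
  {x | (∀ i, C.ineqFun i x ≤ 0) ∧ ∀ j, C.eqFun j x = 0}

/-- Slater points of a set, relative to its representation. -/
structure ConstraintSystem.IsSlaterPoint {E ι κ : Type*} [NormedAddCommGroup E] [NormedSpace ℝ E]
    (C : ConstraintSystem E ι κ) (x : E) : Prop where
  mem_ri_ineq : ∀ i, x ∈ intrinsicInterior ℝ (dom (C.ineqFun i))
  mem_ri_eq : ∀ j, x ∈ intrinsicInterior ℝ (dom (C.eqFun j))
  mem_carrier : x ∈ C.carrier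
  strict : ∀ i, ¬ IsLinearFun (C.ineqFun i) → C.ineqFun i x < 0

/-- The problem of minimizing `obj` subject to the constraints. -/
structure MinProblem (E ι κ : Type*) extends ConstraintSystem E ι κ where
  obj : E → EReal

/-- The problem of maximizing `obj` subject to the constraints. -/
structure MaxProblem (E ι κ : Type*) extends ConstraintSystem E ι κ where
  obj : E → EReal

namespace MinProblem

variable {E ι κ : Type*}

/-- The infimum. -/
def value (P : MinProblem E ι κ) : EReal := ⨅ x ∈ P.carrier, P.obj x

/-- The set of feasible solutions: all constraints hold and the objective is not `+∞`. -/
def feasibleRegion (P : MinProblem E ι κ) : Set E := {x | x ∈ P.carrier ∧ P.obj x ≠ ⊤}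

/-- `x` solves `P`: it is feasible and attains the optimal value; an infeasible problem is solved
by any `x`. -/
def SolvedBy (P : MinProblem E ι κ) (x : E) : Prop :=
  (x ∈ P.feasibleRegion ∧ P.obj x = P.value) ∨ P.feasibleRegion = ∅

def Solvable (P : MinProblem E ι κ) : Prop := ∃ x, P.SolvedBy x

def IsSlaterPoint [NormedAddCommGroup E] [NormedSpace ℝ E] (P : MinProblem E ι κ) (x : E) : Prop :=
  P.toConstraintSystem.IsSlaterPoint x ∧ x ∈ intrinsicInterior ℝ (dom P.obj)

end MinProblem

namespace MaxProblem

variable {E ι κ : Type*}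

/-- The supremum. -/
def value (D : MaxProblem E ι κ) : EReal := ⨆ x ∈ D.carrier, D.obj x

/-- The set of feasible solutions: all constraints hold and the objective is not `-∞`. -/
def feasibleRegion (D : MaxProblem E ι κ) : Set E := {x | x ∈ D.carrier ∧ D.obj x ≠ ⊥}

/-- `x` solves `D`: it is feasible and attains the optimal value; an infeasible problem is solved
by any `x`. -/
def SolvedBy (D : MaxProblem E ι κ) (x : E) : Prop :=
  (x ∈ D.feasibleRegion ∧ D.obj x = D.value) ∨ D.feasibleRegion = ∅

def Solvable (D : MaxProblem E ι κ) : Prop := ∃ x, D.SolvedBy x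

def IsSlaterPoint [NormedAddCommGroup E] [NormedSpace ℝ E] (D : MaxProblem E ι κ) (x : E) : Prop :=
  D.toConstraintSystem.IsSlaterPoint x ∧ x ∈ intrinsicInterior ℝ (dom fun z => - D.obj z)

end MaxProblem

/-! The primal and the dual problem with data `f 0` (objective) and `f 1, …, f m` (constraints). -/

/-- Minimize `f 0 x` subject to `f i x ≤ 0` for `i = 1, …, m`. -/
def primal {d m : ℕ} (f : Fin (m + 1) → EuclideanSpace ℝ (Fin d) → EReal) :
    MinProblem (EuclideanSpace ℝ (Fin d)) (Fin m) Empty where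
  ineqFun i := f i.succ
  eqFun j := j.elim
  obj := f 0

/-- The space of the dual variables `((w_0, …, w_m), (lam_1, …, lam_m))`. -/
abbrev DualSpace (d m : ℕ) : Type :=
  (Fin (m + 1) → EuclideanSpace ℝ (Fin d)) × (Fin m → ℝ)

/-- Maximize `-f_0*(w_0) - ∑ i, lam_i f_i*(w_i / lam_i)` subject to `∑ i, w_i = 0` (one equation
for each of the `d` coordinates) and `-lam_i ≤ 0`. -/
def dual {d m : ℕ} (f : Fin (m + 1) → EuclideanSpace ℝ (Fin d) → EReal) :
    MaxProblem (DualSpace d m) (Fin m) (Fin d) where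
  ineqFun i z := ((-(z.2 i) : ℝ) : EReal)
  eqFun j z := ((∑ i, z.1 i j : ℝ) : EReal)
  obj z := - conj (f 0) (z.1 0) - ∑ i : Fin m, perspective (conj (f i.succ)) (z.1 i.succ) (z.2 i)

end

end ConvexDuality

namespace ConvexDuality

noncomputable section

/-! Relative core points and a relative Farkas lemma. -/

/-! Lift every `f i` to its epigraph. The primal problem then asks for points `(x_i, s_i)` of the
epigraphs with `s_0` minimal under the affine constraints `s_i ≤ 0` and the linear constraints `x_i
= x_0`. Dually, `-(dual f).obj` is the supremum of the functions `lagr q` over tuples `q` of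
epigraph points (`neg_obj_le_iff`); this covers zero and negative multipliers too.

Both problems thus minimize a height over a convex set under affine constraints. `farkas` yields
multipliers for such a problem as soon as some relative core point of the convex set satisfies the
constraints, even with equality. Primal multipliers form a dual solution
(`dual_exists_of_isRelCore`); dual multipliers form a point `x`, which the Fenchel–Moreau theorem
shows to be primal feasible (`primal_exists_of_isRelCore`). Applied at a finite optimal value, each
closes the gap and gives attainment.

It remains to find core points. A Slater point provides one directly. If a feasible region is
bounded, the other problem has a core point: otherwise a nonzero functional is nonpositive on the
image of its convex set under the constraint map, and this functional is a direction along which the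
bounded region contains a ray. -/

/-- `x` is a point of the relative algebraic interior of `S`. -/
def IsRelCore {V : Type*} [AddCommGroup V] [Module ℝ V] (S : Set V) (x : V) : Prop :=
  x ∈ S ∧ ∀ y ∈ S, ∃ ε : ℝ, 0 < ε ∧ x + ε • (x - y) ∈ S

section Farkas

variable {V W : Type*} [AddCommGroup V] [Module ℝ V] [AddCommGroup W] [Module ℝ W]

theorem affine_extrapolate (a : V →ᵃ[ℝ] ℝ) (x y : V) (ε : ℝ) :
    a (x + ε • (x - y)) = a x + ε * (a x - a y) := by
  have h := a.map_vadd x (ε • (x - y))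
  have h2 := a.linearMap_vsub x y
  simp only [vsub_eq_sub, vadd_eq_add] at h h2
  rw [add_comm, h, map_smul, h2, smul_eq_mul]; ring

/-- The core property persists for all smaller step lengths. -/
theorem IsRelCore.exists_forall_le {S : Set V} (hS : Convex ℝ S) {x : V} (hx : IsRelCore S x)
    {y : V} (hy : y ∈ S) :
    ∃ ε : ℝ, 0 < ε ∧ ∀ δ : ℝ, 0 ≤ δ → δ ≤ ε → x + δ • (x - y) ∈ S := by
  obtain ⟨ε, hε, h⟩ := hx.2 y hy
  refine ⟨ε, hε, fun δ h0 h1 => ?_⟩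
  have := hS hx.1 h (a := 1 - δ / ε) (b := δ / ε) (by
    rw [sub_nonneg, div_le_one hε]; exact h1) (by positivity) (by ring)
  convert this using 1
  have : δ / ε * ε = δ := by field_simp
  rw [smul_add, smul_smul, this]
  module

/-- An affine function that is nonnegative on `S` and vanishes at a core point vanishes on `S`. -/
theorem IsRelCore.eq_zero {S : Set V} {x : V} (hx : IsRelCore S x) (a : V →ᵃ[ℝ] ℝ)
    (ha : ∀ y ∈ S, 0 ≤ a y) (h0 : a x = 0) : ∀ y ∈ S, a y = 0 := by
  intro y hy
  obtain ⟨ε, hε, h⟩ := hx.2 y hy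
  have h1 := ha _ h
  rw [affine_extrapolate, h0] at h1
  have h2 := ha y hy
  nlinarith

/-- A segment joining points where `a` has opposite signs meets `a = 0`, where `b ≥ 0`. This bounds
every `-b x / a x` with `a x > 0` by every `b z / (-a z)` with `a z < 0`; the supremum of the former
separates the two families. -/
theorem exists_multiplier {S : Set V} (hS : Convex ℝ S) (a b : V →ᵃ[ℝ] ℝ)
    (h0 : ∀ x ∈ S, a x = 0 → 0 ≤ b x) (hn : ∃ z ∈ S, a z < 0) (hp : ∃ x ∈ S, 0 < a x) :
    ∃ κ : ℝ, ∀ x ∈ S, 0 ≤ b x + κ * a x := by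
  have key : ∀ x ∈ S, 0 < a x → ∀ z ∈ S, a z < 0 → -b x / a x ≤ b z / (-a z) := by
    intro x hx hax z hz haz
    have hd : 0 < a x - a z := by linarith
    have hsum : a x / (a x - a z) + (-a z) / (a x - a z) = 1 := by field_simp; ring
    have hmem := hS hz hx (a := a x / (a x - a z)) (b := (-a z) / (a x - a z))
      (by positivity) (div_nonneg (by linarith) hd.le) hsum
    have h1 := h0 _ hmem (by
      rw [Convex.combo_affine_apply hsum, smul_eq_mul, smul_eq_mul]; field_simp; ring)
    rw [Convex.combo_affine_apply hsum, smul_eq_mul, smul_eq_mul] at h1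
    have h2 : 0 ≤ a x * b z + (-a z) * b x := by
      have : a x / (a x - a z) * b z + (-a z) / (a x - a z) * b x
        = (a x * b z + (-a z) * b x) / (a x - a z) := by ring
      rw [this] at h1
      by_contra hneg
      exact absurd h1 (not_le.2 (div_neg_of_neg_of_pos (not_le.1 hneg) hd))
    rw [div_le_div_iff₀ hax (by linarith)]
    linarith
  obtain ⟨z, hz, haz⟩ := hn
  obtain ⟨x, hx, hax⟩ := hp
  let A : Set ℝ := {r | ∃ x ∈ S, 0 < a x ∧ r = -b x / a x}
  have hA : A.Nonempty := ⟨_, x, hx, hax, rfl⟩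
  have hbdd : BddAbove A := ⟨b z / (-a z), by
    rintro _ ⟨y, hy, hay, rfl⟩; exact key y hy hay z hz haz⟩
  refine ⟨sSup A, fun y hy => ?_⟩
  rcases lt_trichotomy (a y) 0 with h | h | h
  · have : sSup A ≤ b y / (-a y) := csSup_le hA (by
      rintro _ ⟨v, hv, hav, rfl⟩; exact key v hv hav y hy h)
    rw [le_div_iff₀ (by linarith)] at this
    linarith
  · simpa [h] using h0 y hy h
  · have : -b y / a y ≤ sSup A := le_csSup hbdd ⟨y, hy, h, rfl⟩
    rw [div_le_iff₀ h] at this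
    linarith

/-- A negative `κ` may be replaced by `0`: where `a ≤ 0` the hypothesis already gives `b ≥ 0`, and
where `a > 0` the change only increases the sum. -/
theorem exists_nonneg_multiplier {S : Set V} (hS : Convex ℝ S) (a b : V →ᵃ[ℝ] ℝ)
    (h0 : ∀ x ∈ S, a x ≤ 0 → 0 ≤ b x) (hn : ∃ z ∈ S, a z < 0) :
    ∃ κ : ℝ, 0 ≤ κ ∧ ∀ x ∈ S, 0 ≤ b x + κ * a x := by
  by_cases hp : ∃ x ∈ S, 0 < a x
  · obtain ⟨κ, hκ⟩ := exists_multiplier hS a b (fun x hx h => h0 x hx h.le) hn hp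
    refine ⟨max κ 0, le_max_right _ _, fun x hx => ?_⟩
    rcases le_total κ 0 with h | h
    · rw [max_eq_right h]
      rcases le_total (a x) 0 with h1 | h1
      · simpa using h0 x hx h1
      · nlinarith [hκ x hx]
    · rw [max_eq_left h]; exact hκ x hx
  · push Not at hp
    exact ⟨0, le_rfl, fun x hx => by simpa using h0 x hx (hp x hx)⟩

/-- Unless `a` vanishes on `S`, extrapolating from a point with `a ≠ 0` through the core point `x₀`
reaches the opposite sign, so both signs occur. -/
theorem exists_free_multiplier {S : Set V} (hS : Convex ℝ S) {x₀ : V} (hx₀ : IsRelCore S x₀)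
    (a b : V →ᵃ[ℝ] ℝ) (ha : a x₀ = 0) (h0 : ∀ x ∈ S, a x = 0 → 0 ≤ b x) :
    ∃ κ : ℝ, ∀ x ∈ S, 0 ≤ b x + κ * a x := by
  by_cases hall : ∀ x ∈ S, a x = 0
  · exact ⟨0, fun x hx => by simpa using h0 x hx (hall x hx)⟩
  push Not at hall
  obtain ⟨y, hy, hay⟩ := hall
  obtain ⟨ε, hε, hmem⟩ := hx₀.2 y hy
  have hval := affine_extrapolate a x₀ y ε
  rw [ha] at hval
  rcases lt_or_gt_of_ne hay with h | h
  · exact exists_multiplier hS a b h0 ⟨y, hy, h⟩ ⟨_, hmem, by rw [hval]; nlinarith⟩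
  · exact exists_multiplier hS a b h0 ⟨_, hmem, by rw [hval]; nlinarith⟩ ⟨y, hy, h⟩

theorem affine_sum_apply {ι : Type*} (a : ι → V →ᵃ[ℝ] ℝ) (μ : ι → ℝ) (s : Finset ι) (x : V) :
    (∑ i ∈ s, μ i • a i : V →ᵃ[ℝ] ℝ) x = ∑ i ∈ s, μ i * a i x := by
  classical
  induction s using Finset.induction_on with
  | empty => simp
  | insert k t hk ih => simp [Finset.sum_insert hk, ih]

/-- Induction on the constraints. If the new one can be strict while the others hold, a
one-constraint multiplier is absorbed into `b`. Otherwise it is an implicit equality, and the core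
point `x₀` replaces strict feasibility. -/
theorem farkas {ι : Type*} (a : ι → V →ᵃ[ℝ] ℝ) {x₀ : V} (s : Finset ι) :
    ∀ S : Set V, Convex ℝ S → IsRelCore S x₀ → (∀ i ∈ s, a i x₀ ≤ 0) → ∀ b : V →ᵃ[ℝ] ℝ,
      (∀ x ∈ S, (∀ i ∈ s, a i x ≤ 0) → 0 ≤ b x) →
      ∃ μ : ι → ℝ, (∀ i, 0 ≤ μ i) ∧ ∀ x ∈ S, 0 ≤ b x + ∑ i ∈ s, μ i * a i x := by
  classical
  induction s using Finset.induction_on with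
  | empty =>
    intro S _ _ _ b hb
    exact ⟨0, fun _ => le_rfl, fun x hx => by simpa using hb x hx (by simp)⟩
  | insert j s hj ih =>
    intro S hS hx₀ hneg b hb
    have hneg' : ∀ i ∈ s, a i x₀ ≤ 0 := fun i hi => hneg i (Finset.mem_insert_of_mem hi)
    have hsum : ∀ (μ : ι → ℝ) (κ : ℝ) (x : V),
        ∑ i ∈ insert j s, Function.update μ j κ i * a i x
          = κ * a j x + ∑ i ∈ s, μ i * a i x := by
      intro μ κ x
      rw [Finset.sum_insert hj, Function.update_self]
      congr 1
      refine Finset.sum_congr rfl fun i hi => ?_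
      rw [Function.update_of_ne (by rintro rfl; exact hj hi)]
    have hupd : ∀ (μ : ι → ℝ) (κ : ℝ), (∀ i, 0 ≤ μ i) → 0 ≤ κ →
        ∀ i, 0 ≤ Function.update μ j κ i := by
      intro μ κ hμ hκ i
      by_cases h : i = j
      · subst h; simpa using hκ
      · simpa [Function.update_of_ne h] using hμ i
    by_cases hz : ∃ z ∈ S, (∀ i ∈ s, a i z ≤ 0) ∧ a j z < 0
    · obtain ⟨z, hzS, hzs, hzj⟩ := hz
      have hconv : Convex ℝ {x | x ∈ S ∧ ∀ i ∈ s, a i x ≤ 0} := by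
        rintro x ⟨hx, hxs⟩ y ⟨hy, hys⟩ α β hα hβ hαβ
        refine ⟨hS hx hy hα hβ hαβ, fun i hi => ?_⟩
        rw [Convex.combo_affine_apply hαβ, smul_eq_mul, smul_eq_mul]
        nlinarith [mul_nonpos_of_nonneg_of_nonpos hα (hxs i hi),
          mul_nonpos_of_nonneg_of_nonpos hβ (hys i hi)]
      obtain ⟨κ, hκ, h⟩ := exists_nonneg_multiplier hconv (a j) b (fun x hx hxj =>
        hb x hx.1 (by simpa using ⟨hxj, hx.2⟩)) ⟨z, ⟨hzS, hzs⟩, hzj⟩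
      obtain ⟨μ, hμ, h'⟩ := ih S hS hx₀ hneg' (b + κ • a j) (fun x hx hxs => by
        simpa using h x ⟨hx, hxs⟩)
      refine ⟨Function.update μ j κ, hupd μ κ hμ hκ, fun x hx => ?_⟩
      rw [hsum, ← add_assoc]
      simpa using h' x hx
    · push Not at hz
      obtain ⟨ν, hν, h⟩ := ih S hS hx₀ hneg' (a j) hz
      have hx₀j : a j x₀ = 0 :=
        le_antisymm (hneg j (Finset.mem_insert_self _ _)) (hz x₀ hx₀.1 hneg')
      -- `g` is nonnegative on `S` and vanishes at `x₀`, hence vanishes on all of `S`; multiples of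
      -- it can be added freely.
      let g : V →ᵃ[ℝ] ℝ := a j + ∑ i ∈ s, ν i • a i
      have hg : ∀ x, g x = a j x + ∑ i ∈ s, ν i * a i x := by
        intro x
        simp [g, affine_sum_apply]
      have hgx₀ : g x₀ = 0 := by
        refine le_antisymm ?_ (by rw [hg]; exact h x₀ hx₀.1)
        rw [hg, hx₀j, zero_add]
        exact Finset.sum_nonpos fun i hi => mul_nonpos_of_nonneg_of_nonpos (hν i) (hneg' i hi)
      have hg0 := hx₀.eq_zero g (fun y hy => by rw [hg]; exact h y hy) hgx₀
      have hconv : Convex ℝ {x | x ∈ S ∧ a j x = 0} := by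
        rintro x ⟨hx, hxs⟩ y ⟨hy, hys⟩ α β hα hβ hαβ
        refine ⟨hS hx hy hα hβ hαβ, ?_⟩
        rw [Convex.combo_affine_apply hαβ, hxs, hys]; simp
      have hcore : IsRelCore {x | x ∈ S ∧ a j x = 0} x₀ := by
        refine ⟨⟨hx₀.1, hx₀j⟩, fun y hy => ?_⟩
        obtain ⟨ε, hε, hmem⟩ := hx₀.2 y hy.1
        exact ⟨ε, hε, hmem, by rw [affine_extrapolate, hx₀j, hy.2]; simp⟩
      obtain ⟨μ, hμ, hb'⟩ := ih _ hconv hcore hneg' b (fun x hx hxs =>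
        hb x hx.1 (by simpa using ⟨hx.2.le, hxs⟩))
      let b' : V →ᵃ[ℝ] ℝ := b + ∑ i ∈ s, μ i • a i
      have hb'' : ∀ x, b' x = b x + ∑ i ∈ s, μ i * a i x := by
        intro x
        simp [b', affine_sum_apply]
      obtain ⟨κ, hκ⟩ := exists_free_multiplier hS hx₀ (a j) b' hx₀j (fun x hx hxj => by
        rw [hb'']; exact hb' x ⟨hx, hxj⟩)
      -- The free multiplier `κ` may be negative; adding `|κ| • g`, which is zero on `S`, makes all
      -- multipliers nonnegative.
      refine ⟨Function.update (fun i => μ i + |κ| * ν i) j (κ + |κ|), hupd _ _ (fun i => ?_) ?_,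
        fun x hx => ?_⟩
      · have := hμ i; have := hν i; positivity
      · linarith [neg_abs_le κ]
      · rw [hsum]
        have h1 := hκ x hx
        have h2 := hg0 x hx
        rw [hb''] at h1
        rw [hg] at h2
        have h3 : ∑ i ∈ s, (μ i + |κ| * ν i) * a i x
            = ∑ i ∈ s, μ i * a i x + |κ| * ∑ i ∈ s, ν i * a i x := by
          rw [Finset.mul_sum, ← Finset.sum_add_distrib]
          exact Finset.sum_congr rfl fun i _ => by ring
        rw [h3]
        linear_combination h1 - |κ| * h2

/-- Each coordinate of `T x = 0` becomes two opposite inequalities. Both are tight at `x₀`, which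
`farkas` permits. -/
theorem farkas_eq {ι : Type*} [Fintype ι] [FiniteDimensional ℝ W] {S : Set V} (hS : Convex ℝ S)
    {x₀ : V} (hx₀ : IsRelCore S x₀) (a : ι → V →ᵃ[ℝ] ℝ) (ha : ∀ i, a i x₀ ≤ 0)
    (T : V →ₗ[ℝ] W) (hT : T x₀ = 0) (b : V →ᵃ[ℝ] ℝ)
    (hb : ∀ x ∈ S, (∀ i, a i x ≤ 0) → T x = 0 → 0 ≤ b x) :
    ∃ (μ : ι → ℝ) (φ : W →ₗ[ℝ] ℝ), (∀ i, 0 ≤ μ i) ∧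
      ∀ x ∈ S, 0 ≤ b x + ∑ i, μ i * a i x + φ (T x) := by
  let B := Module.finBasis ℝ W
  let e : Fin (Module.finrank ℝ W) → V →ᵃ[ℝ] ℝ := fun j => ((B.coord j).comp T).toAffineMap
  obtain ⟨μ, hμ, h⟩ := farkas (Sum.elim a (Sum.elim e (fun j => -e j))) (x₀ := x₀)
    Finset.univ S hS hx₀ (by
      rintro (i | i | i) - <;> simp [e, hT, ha]) b (by
      intro x hx hi
      refine hb x hx (fun i => hi (.inl i) (Finset.mem_univ _)) ?_
      refine B.ext_elem fun j => ?_
      have h1 := hi (.inr (.inl j)) (Finset.mem_univ _)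
      have h2 := hi (.inr (.inr j)) (Finset.mem_univ _)
      simp [e] at h1 h2
      simpa using le_antisymm h1 h2)
  refine ⟨fun i => μ (.inl i), ∑ j, (μ (.inr (.inl j)) - μ (.inr (.inr j))) • B.coord j,
    fun i => hμ _, fun x hx => ?_⟩
  have h1 := h x hx
  rw [Fintype.sum_sum_type, Fintype.sum_sum_type] at h1
  refine h1.trans_eq ?_
  simp [e, sub_mul, Finset.sum_sub_distrib]
  ring

end Farkas

/-! Relative core points and the relative interior. -/

section Topological

variable {V W : Type*} [NormedAddCommGroup V] [NormedSpace ℝ V]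
  [NormedAddCommGroup W] [NormedSpace ℝ W]

theorem isRelCore_of_mem_intrinsicInterior {S : Set V} {x : V}
    (hx : x ∈ intrinsicInterior ℝ S) : IsRelCore S x := by
  refine ⟨intrinsicInterior_subset hx, fun y hy => ?_⟩
  rw [mem_intrinsicInterior] at hx
  obtain ⟨x', hx', rfl⟩ := hx
  let y' : affineSpan ℝ S := ⟨y, subset_affineSpan ℝ S hy⟩
  let γ : ℝ → affineSpan ℝ S := fun t =>
    ⟨(x' : V) + t • ((x' : V) - y), by
      have := AffineMap.lineMap_mem (1 + t) y'.2 x'.2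
      rw [AffineMap.lineMap_apply] at this
      convert this using 1
      simp only [vsub_eq_sub, vadd_eq_add, y']
      module⟩
  have hγ : Continuous γ := by
    refine Continuous.subtype_mk ?_ _
    fun_prop
  have h0 : γ 0 = x' := by ext; simp [γ]
  have hn : γ ⁻¹' interior ((↑) ⁻¹' S : Set (affineSpan ℝ S)) ∈ nhds (0 : ℝ) := by
    refine hγ.continuousAt.preimage_mem_nhds ?_
    rw [h0]; exact isOpen_interior.mem_nhds hx'
  obtain ⟨ε, hε, hsub⟩ := Metric.mem_nhds_iff.1 hn
  refine ⟨ε / 2, by positivity, ?_⟩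
  have : (ε / 2 : ℝ) ∈ Metric.ball (0 : ℝ) ε := by
    rw [mem_ball_zero_iff, Real.norm_of_nonneg (by positivity)]; linarith
  exact interior_subset (s := ((↑) ⁻¹' S : Set (affineSpan ℝ S))) (hsub this)

theorem exists_isRelCore [FiniteDimensional ℝ V] {S : Set V} (hS : Convex ℝ S)
    (hne : S.Nonempty) : ∃ x, IsRelCore S x := by
  obtain ⟨x, hx⟩ := hne.intrinsicInterior hS
  exact ⟨x, isRelCore_of_mem_intrinsicInterior hx⟩

/-- A convex set that lies in no half-space through the origin has the origin in its interior. -/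
theorem zero_mem_interior [FiniteDimensional ℝ W] {C : Set W} (hC : Convex ℝ C)
    (hne : C.Nonempty) (h : ∀ φ : W →ₗ[ℝ] ℝ, φ ≠ 0 → ∃ c ∈ C, 0 < φ c) :
    (0 : W) ∈ interior C := by
  have hint : (interior C).Nonempty := by
    rw [hC.interior_nonempty_iff_affineSpan_eq_top]
    -- Otherwise some `φ ≠ 0` is constant on `C`, and the hypothesis for `φ` and `-φ` gives this
    -- constant both signs.
    by_contra htop
    obtain ⟨c₀, hc₀⟩ := hne
    have hdir : (affineSpan ℝ C).direction ≠ ⊤ := by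
      intro hd
      exact htop ((AffineSubspace.direction_eq_top_iff_of_nonempty
        ⟨c₀, subset_affineSpan ℝ C hc₀⟩).1 hd)
    obtain ⟨φ, hφ0, hφ⟩ := Submodule.exists_le_ker_of_lt_top _ (lt_top_iff_ne_top.2 hdir)
    have hconst : ∀ c ∈ C, φ c = φ c₀ := by
      intro c hc
      have := hφ (AffineSubspace.vsub_mem_direction (subset_affineSpan ℝ C hc)
        (subset_affineSpan ℝ C hc₀))
      rw [LinearMap.mem_ker, vsub_eq_sub, map_sub] at this
      linarith
    obtain ⟨c, hc, hpos⟩ := h φ hφ0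
    obtain ⟨c', hc', hpos'⟩ := h (-φ) (neg_ne_zero.2 hφ0)
    rw [LinearMap.neg_apply, hconst c' hc'] at hpos'
    rw [hconst c hc] at hpos
    linarith
  by_contra h0
  obtain ⟨φ, hφ⟩ := geometric_hahn_banach_open_point hC.interior isOpen_interior h0
  simp only [map_zero] at hφ
  have hle : ∀ c ∈ C, φ c ≤ 0 := by
    intro c hc
    have hcl : c ∈ closure (interior C) := by
      rw [hC.closure_interior_eq_closure_of_nonempty_interior hint]; exact subset_closure hc
    exact closure_minimal (fun y hy => (hφ y hy).le)
      (isClosed_le φ.continuous continuous_const) hcl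
  obtain ⟨y, hy⟩ := hint
  obtain ⟨c, hc, hpos⟩ := h φ.toLinearMap (by
    intro h0
    have h1 := hφ y hy
    have h2 : φ y = 0 := by
      have := LinearMap.congr_fun h0 y
      simpa using this
    linarith)
  exact absurd (hle c hc) (not_le.2 hpos)

/-- The image of `S` surrounds `0`, so it contains `-δ • T v₁` for a core point `v₁` and small `δ >
0`. Averaging a preimage with `v₁` cancels the image, and the positive weight of `v₁` preserves the
core property. -/
theorem exists_isRelCore_of_map_eq_zero [FiniteDimensional ℝ V] [FiniteDimensional ℝ W]
    {S : Set V} (hS : Convex ℝ S) (hne : S.Nonempty) (T : V →ₗ[ℝ] W)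
    (h : ∀ φ : W →ₗ[ℝ] ℝ, φ ≠ 0 → ∃ v ∈ S, 0 < φ (T v)) :
    ∃ v, IsRelCore S v ∧ T v = 0 := by
  obtain ⟨v₁, hv₁⟩ := exists_isRelCore hS hne
  have h0 : (0 : W) ∈ interior (T '' S) :=
    zero_mem_interior (hS.linear_image T) (hne.image T) (fun φ hφ => by simpa using h φ hφ)
  have hn : (fun t : ℝ => (-t) • T v₁) ⁻¹' (T '' S) ∈ nhds (0 : ℝ) := by
    refine (by fun_prop : Continuous fun t : ℝ => (-t) • T v₁).continuousAt.preimage_mem_nhds ?_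
    simpa using mem_interior_iff_mem_nhds.1 h0
  obtain ⟨ε, hε, hsub⟩ := Metric.mem_nhds_iff.1 hn
  have hmem : (ε / 2 : ℝ) ∈ Metric.ball (0 : ℝ) ε := by
    rw [mem_ball_zero_iff, Real.norm_of_nonneg (by positivity)]; linarith
  obtain ⟨v₂, hv₂, hT⟩ := hsub hmem
  set δ := ε / 2
  have hδ : 0 < δ := by positivity
  have hα : 0 < 1 / (1 + δ) := by positivity
  have hβ : 0 < δ / (1 + δ) := by positivity
  have hαβ : 1 / (1 + δ) + δ / (1 + δ) = 1 := by field_simp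
  refine ⟨(1 / (1 + δ)) • v₂ + (δ / (1 + δ)) • v₁,
    ⟨hS hv₂ hv₁.1 hα.le hβ.le hαβ, fun y hy => ?_⟩, ?_⟩
  · obtain ⟨η, hη, hmem'⟩ := hv₁.2 y hy
    -- the new point is an average of `v₂`, the extrapolated point and the chosen one
    refine ⟨δ * η / (1 + δ + η), by positivity, ?_⟩
    have h2 : 0 < 1 + δ + η := by positivity
    have h3 := hS hv₂ hmem' (a := (1 + η) / (1 + δ + η)) (b := δ / (1 + δ + η))
      (by positivity) (by positivity) (by field_simp; ring)
    convert h3 using 1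
    match_scalars <;> field_simp <;> ring
  · rw [map_add, map_smul, map_smul, hT, smul_smul, ← add_smul]
    have : 1 / (1 + δ) * -δ + δ / (1 + δ) = 0 := by ring
    rw [this, zero_smul]

end Topological

/-! Core points of epigraphs and of products. -/

section Core

variable {V : Type*} [AddCommGroup V] [Module ℝ V]

theorem exists_real_ge_of_lt_top {a : EReal} (h : a < ⊤) : ∃ r : ℝ, a ≤ r := by
  obtain ⟨r, hr, _⟩ := EReal.lt_iff_exists_real_btwn.1 h
  exact ⟨r, hr.le⟩

theorem convex_dom {f : V → EReal} (hf : IsConvexFun f) : Convex ℝ (dom f) := by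
  intro x hx y hy a b ha hb hab
  obtain ⟨r, hr⟩ := exists_real_ge_of_lt_top hx
  obtain ⟨s, hs⟩ := exists_real_ge_of_lt_top hy
  have := hf (x := (x, r)) hr (y := (y, s)) hs ha hb hab
  exact lt_of_le_of_lt this (EReal.coe_lt_top _)

theorem isRelCore_epi {f : V → EReal} (hf : IsConvexFun f) {x : V} (hx : IsRelCore (dom f) x)
    {s : ℝ} (hs : f x < s) : IsRelCore (epi f) (x, s) := by
  refine ⟨hs.le, ?_⟩
  rintro ⟨y, σ⟩ hy
  obtain ⟨ε, hε, hmem⟩ := hx.2 y (lt_of_le_of_lt hy (EReal.coe_lt_top _))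
  obtain ⟨σ', hσ'⟩ := exists_real_ge_of_lt_top hmem
  obtain ⟨r, hr, hrs⟩ := EReal.lt_iff_exists_real_btwn.1 hs
  have hrs : r < s := by exact_mod_cast hrs
  -- The step `θ` must satisfy `θ * (σ' - r - ε * (s - σ)) ≤ s - r`; the extra summand in `K` makes
  -- `K` positive and `θ ≤ 1`.
  set K := |σ' - r - ε * (s - σ)| + (s - r) with hK
  have hKpos : 0 < K := by have := abs_nonneg (σ' - r - ε * (s - σ)); linarith
  set θ := (s - r) / K with hθdef
  have hθ : 0 < θ := div_pos (by linarith) hKpos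
  have hθ1 : θ ≤ 1 := by
    rw [hθdef, div_le_one hKpos]
    have := abs_nonneg (σ' - r - ε * (s - σ)); linarith
  have hθK : θ * K = s - r := by rw [hθdef]; field_simp
  have h1 := hf (x := (x, r)) hr.le (y := (x + ε • (x - y), σ')) hσ' (a := 1 - θ) (b := θ)
    (by linarith) hθ.le (by ring)
  refine ⟨θ * ε, by positivity, ?_⟩
  have h2 : (1 - θ) • x + θ • (x + ε • (x - y)) = x + (θ * ε) • (x - y) := by module
  have h3 : f ((1 - θ) • x + θ • (x + ε • (x - y))) ≤ (((1 - θ) * r + θ * σ' : ℝ) : EReal) := h1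
  rw [h2] at h3
  refine h3.trans (EReal.coe_le_coe_iff.2 ?_)
  change (1 - θ) * r + θ * σ' ≤ s + θ * ε * (s - σ)
  have h4 := mul_le_mul_of_nonneg_left (le_abs_self (σ' - r - ε * (s - σ))) hθ.le
  nlinarith [mul_pos hθ (sub_pos.2 hrs)]

/-- For affine constraints the graph replaces the epigraph: all its points are core points, so no
strict inequality is needed. -/
theorem isRelCore_graph (g : V →ᵃ[ℝ] ℝ) (x : V) :
    IsRelCore {p : V × ℝ | p.2 = g p.1} (x, g x) := by
  refine ⟨rfl, ?_⟩
  rintro ⟨y, σ⟩ hy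
  refine ⟨1, one_pos, ?_⟩
  change σ = g y at hy
  change g x + 1 * (g x - σ) = g (x + (1 : ℝ) • (x - y))
  rw [affine_extrapolate, hy]

theorem convex_graph (g : V →ᵃ[ℝ] ℝ) : Convex ℝ {p : V × ℝ | p.2 = g p.1} := by
  rintro ⟨x, r⟩ hx ⟨y, s⟩ hy a b ha hb hab
  change r = g x at hx
  change s = g y at hy
  change a * r + b * s = g (a • x + b • y)
  rw [Convex.combo_affine_apply hab, hx, hy, smul_eq_mul, smul_eq_mul]

theorem isRelCore_pi {ι : Type*} [Finite ι] [Nonempty ι] {S : ι → Set V}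
    (hS : ∀ i, Convex ℝ (S i)) {q : ι → V} (hq : ∀ i, IsRelCore (S i) (q i)) :
    IsRelCore (Set.univ.pi S) q := by
  refine ⟨fun i _ => (hq i).1, fun y hy => ?_⟩
  choose ε hε h using fun i => (hq i).exists_forall_le (hS i) (hy i trivial)
  obtain ⟨k, hk⟩ := Finite.exists_min ε
  exact ⟨ε k, hε k, fun i _ => h i (ε k) (hε k).le (hk i)⟩

end Core

/-! The Fenchel–Moreau theorem and perspectives, in terms of epigraphs. -/

section Conjugate

variable {E : Type*} [NormedAddCommGroup E] [InnerProductSpace ℝ E]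

theorem coe_sub_le_iff {a : EReal} (ha : ⊥ < a) (r c : ℝ) :
    (r : EReal) - a ≤ c ↔ ∀ s : ℝ, a ≤ s → r - s ≤ c := by
  induction a with
  | bot => exact absurd ha (lt_irrefl _)
  | coe a =>
    rw [← EReal.coe_sub, EReal.coe_le_coe_iff]
    exact ⟨fun h s hs => by rw [EReal.coe_le_coe_iff] at hs; linarith, fun h => h a le_rfl⟩
  | top => simp

/-- Real upper bounds over the epigraph replace extended arithmetic; the later results on
perspectives and the dual objective have this form. -/
theorem conj_le_iff {f : E → EReal} (hf : ∀ x, ⊥ < f x) (w : E) (c : ℝ) :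
    conj f w ≤ c ↔ ∀ p ∈ epi f, inner ℝ p.1 w - p.2 ≤ c := by
  rw [conj, iSup_le_iff]
  constructor
  · rintro h ⟨x, s⟩ hp
    exact (coe_sub_le_iff (hf x) _ _).1 (h x) s hp
  · intro h x
    exact (coe_sub_le_iff (hf x) _ _).2 fun s hs => h (x, s) hs

theorem bot_lt_conj {f : E → EReal} (hf : IsProper f) (w : E) : ⊥ < conj f w := by
  obtain ⟨x, hx⟩ := hf.2
  obtain ⟨s, hs⟩ := exists_real_ge_of_lt_top hx
  by_contra h
  have h0 : conj f w = ⊥ := not_bot_lt_iff.1 h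
  have := (conj_le_iff hf.1 w (inner ℝ x w - s - 1)).1 (by rw [h0]; exact bot_le) (x, s) hs
  simp only at this
  linarith

theorem isClosed_epi {X : Type*} [TopologicalSpace X] {f : X → EReal}
    (hf : LowerSemicontinuous f) : IsClosed (epi f) :=
  hf.isClosed_epigraph.preimage
    (continuous_fst.prodMk (continuous_coe_real_ereal.comp continuous_snd))

/-- Separation of a point from an epigraph by a hyperplane with nonnegative vertical slope. -/
theorem exists_separation [FiniteDimensional ℝ E] {f : E → EReal} (hp : IsProper f)
    (hc : IsClosedFun f) (hf : IsConvexFun f) {p : E × ℝ} (hpe : p ∉ epi f) :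
    ∃ (v : E) (β u : ℝ), 0 ≤ β ∧ inner ℝ p.1 v + β * p.2 < u ∧
      ∀ q ∈ epi f, u < inner ℝ q.1 v + β * q.2 := by
  obtain ⟨φ, u, h1, h2⟩ := geometric_hahn_banach_point_closed hf (isClosed_epi hc.1) hpe
  let v := (InnerProductSpace.toDual ℝ E).symm (φ.comp (ContinuousLinearMap.inl ℝ E ℝ))
  have hφ : ∀ q : E × ℝ, φ q = inner ℝ q.1 v + φ (0, 1) * q.2 := by
    rintro ⟨x, s⟩
    have e1 : inner ℝ x v = φ (x, 0) := by
      rw [real_inner_comm, InnerProductSpace.toDual_symm_apply]; rfl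
    have e2 : φ (0, 1) * s = φ (0, s) := by
      have : ((0 : E), s) = s • ((0 : E), (1 : ℝ)) := by simp
      rw [this, map_smul, smul_eq_mul, mul_comm]
    rw [e1, e2, ← map_add]; simp
  refine ⟨v, φ (0, 1), u, ?_, by rwa [← hφ], fun q hq => by rw [← hφ]; exact h2 q hq⟩
  obtain ⟨x, hx⟩ := hp.2
  obtain ⟨s, hs⟩ := exists_real_ge_of_lt_top hx
  by_contra hneg
  push Not at hneg
  set β := φ (0, 1)
  have hdiv : β * ((u - inner ℝ x v) / β) = u - inner ℝ x v :=
    mul_div_cancel₀ _ hneg.ne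
  have hmax : (x, max s ((u - inner ℝ x v) / β)) ∈ epi f :=
    hs.trans (EReal.coe_le_coe_iff.2 (le_max_left _ _))
  have h3 := h2 _ hmax
  rw [hφ] at h3
  have h4 := mul_le_mul_of_nonpos_left (le_max_right s ((u - inner ℝ x v) / β)) hneg.le
  simp only at h3
  linarith

theorem exists_conj_of_slope_pos {f : E → EReal} (hp : IsProper f) {p : E × ℝ} {v : E} {β u : ℝ}
    (hβ : 0 < β) (h1 : inner ℝ p.1 v + β * p.2 < u)
    (h2 : ∀ q ∈ epi f, u < inner ℝ q.1 v + β * q.2) :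
    ∃ (w : E) (c : ℝ), conj f w ≤ c ∧ c < inner ℝ p.1 w - p.2 := by
  refine ⟨(-β⁻¹) • v, -(β⁻¹ * u), (conj_le_iff hp.1 _ _).2 fun q hq => ?_, ?_⟩
  · have := mul_lt_mul_of_pos_left (h2 q hq) (inv_pos.2 hβ)
    rw [mul_add, ← mul_assoc, inv_mul_cancel₀ hβ.ne', one_mul] at this
    rw [real_inner_smul_right]; linarith
  · have := mul_lt_mul_of_pos_left h1 (inv_pos.2 hβ)
    rw [mul_add, ← mul_assoc, inv_mul_cancel₀ hβ.ne', one_mul] at this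
    rw [real_inner_smul_right]; linarith

theorem exists_conj_le [FiniteDimensional ℝ E] {f : E → EReal} (hp : IsProper f)
    (hc : IsClosedFun f) (hf : IsConvexFun f) : ∃ (w : E) (c : ℝ), conj f w ≤ c := by
  obtain ⟨x, hx⟩ := hp.2
  obtain ⟨s, hs⟩ := exists_real_ge_of_lt_top hx
  obtain ⟨r, -, hr⟩ := EReal.lt_iff_exists_real_btwn.1 (hp.1 x)
  obtain ⟨v, β, u, hβ, h1, h2⟩ := exists_separation hp hc hf (p := (x, r)) (not_le.2 hr)
  -- A vertical hyperplane cannot separate two points over the same `x`.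
  have hβ' : 0 < β := by
    refine lt_of_le_of_ne hβ fun h => ?_
    have := h2 (x, s) hs
    rw [← h] at this h1
    simp only at this h1
    linarith
  obtain ⟨w, c, hw, -⟩ := exists_conj_of_slope_pos hp hβ' h1 h2
  exact ⟨w, c, hw⟩

/-- The Fenchel–Moreau theorem. -/
theorem mem_epi_iff [FiniteDimensional ℝ E] {f : E → EReal} (hp : IsProper f)
    (hc : IsClosedFun f) (hf : IsConvexFun f) (p : E × ℝ) :
    p ∈ epi f ↔ ∀ (w : E) (c : ℝ), conj f w ≤ c → inner ℝ p.1 w - p.2 ≤ c := by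
  refine ⟨fun h w c hw => (conj_le_iff hp.1 w c).1 hw p h, fun h => ?_⟩
  by_contra hpe
  obtain ⟨v, β, u, hβ, h1, h2⟩ := exists_separation hp hc hf hpe
  rcases hβ.lt_or_eq with hβ | rfl
  · obtain ⟨w, c, hw, hlt⟩ := exists_conj_of_slope_pos hp hβ h1 h2
    exact absurd (h w c hw) (not_le.2 hlt)
  · obtain ⟨w₀, c₀, hw₀⟩ := exists_conj_le hp hc hf
    simp only [zero_mul, add_zero] at h1 h2
    -- When the separating hyperplane is vertical, adding `t` times it to a known affine minorant
    -- again gives a minorant; for large `t` it passes above `p`.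
    have key : ∀ t : ℝ, 0 ≤ t → inner ℝ p.1 w₀ - t * inner ℝ p.1 v - p.2 ≤ c₀ - t * u := by
      intro t ht
      have := h (w₀ - t • v) (c₀ - t * u) ((conj_le_iff hp.1 _ _).2 fun q hq => by
        have e1 := (conj_le_iff hp.1 _ _).1 hw₀ q hq
        have e2 := mul_le_mul_of_nonneg_left (h2 q hq).le ht
        rw [inner_sub_right, real_inner_smul_right]; linarith)
      rwa [inner_sub_right, real_inner_smul_right] at this
    have hd : 0 < u - inner ℝ p.1 v := by linarith
    set K := c₀ - inner ℝ p.1 w₀ + p.2 with hK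
    have := key ((|K| + 1) / (u - inner ℝ p.1 v)) (by positivity)
    have hdiv : (|K| + 1) / (u - inner ℝ p.1 v) * (u - inner ℝ p.1 v) = |K| + 1 := by
      field_simp
    have := le_abs_self K
    nlinarith

theorem dom_conj_conj [FiniteDimensional ℝ E] {f : E → EReal} (hp : IsProper f)
    (hc : IsClosedFun f) (hf : IsConvexFun f) : dom (conj (conj f)) = dom f := by
  have key : ∀ (x : E) (s : ℝ), conj (conj f) x ≤ s ↔ f x ≤ s := by
    intro x s
    rw [conj_le_iff (bot_lt_conj hp)]
    refine Iff.trans ?_ (mem_epi_iff hp hc hf (x, s)).symm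
    constructor
    · intro h w c hw
      have := h (w, c) hw
      simp only [real_inner_comm] at this ⊢
      linarith
    · rintro h ⟨w, c⟩ hw
      have := h w c hw
      simp only [real_inner_comm] at this ⊢
      linarith
  ext x
  constructor
  · intro hx
    obtain ⟨s, hs⟩ := exists_real_ge_of_lt_top hx
    exact lt_of_le_of_lt ((key x s).1 hs) (EReal.coe_lt_top _)
  · intro hx
    obtain ⟨s, hs⟩ := exists_real_ge_of_lt_top hx
    exact lt_of_le_of_lt ((key x s).2 hs) (EReal.coe_lt_top _)

theorem coe_mul_le_iff {t : ℝ} (ht : 0 < t) (a : EReal) (c : ℝ) :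
    (t : EReal) * a ≤ c ↔ a ≤ ((c / t : ℝ) : EReal) := by
  induction a with
  | bot => simp [EReal.coe_mul_bot_of_pos ht]
  | coe a => rw [← EReal.coe_mul, EReal.coe_le_coe_iff, EReal.coe_le_coe_iff, le_div_iff₀' ht]
  | top => simp [EReal.coe_mul_top_of_pos ht]

/-- One formula covers all signs of `t`: the perspective is the supremum of `⟨x, w⟩ - t s` over the
epigraph. For `t < 0` unbounded heights make it infinite; for `t = 0` the heights drop out and the
support function of `dom f` remains. -/
theorem perspective_conj_le_iff [FiniteDimensional ℝ E] {f : E → EReal} (hp : IsProper f)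
    (hc : IsClosedFun f) (hf : IsConvexFun f) (w : E) (t c : ℝ) :
    perspective (conj f) w t ≤ c ↔ ∀ p ∈ epi f, inner ℝ p.1 w - t * p.2 ≤ c := by
  obtain ⟨x, hx⟩ := hp.2
  obtain ⟨s, hs⟩ := exists_real_ge_of_lt_top hx
  rcases lt_trichotomy t 0 with ht | rfl | ht
  · rw [perspective, if_neg (not_lt.2 ht.le), if_neg ht.ne]
    refine ⟨fun h => absurd h (by simp), fun h => ?_⟩
    exfalso
    set M := (c + 1 - inner ℝ x w) / (-t)
    have hM : (-t) * M = c + 1 - inner ℝ x w := mul_div_cancel₀ _ (by linarith)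
    have h1 := h (x, max s M) (hs.trans (EReal.coe_le_coe_iff.2 (le_max_left _ _)))
    have h2 := mul_le_mul_of_nonneg_left (le_max_right s M) (by linarith : 0 ≤ -t)
    simp only at h1
    linarith
  · rw [perspective, if_neg (lt_irrefl _), if_pos rfl, dom_conj_conj hp hc hf, supportFun]
    simp only [iSup_le_iff, EReal.coe_le_coe_iff, zero_mul, sub_zero]
    constructor
    · rintro h ⟨y, r⟩ hy
      exact h y (lt_of_le_of_lt hy (EReal.coe_lt_top _))
    · intro h y hy
      obtain ⟨r, hr⟩ := exists_real_ge_of_lt_top hy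
      exact h (y, r) hr
  · rw [perspective, if_pos ht, coe_mul_le_iff ht, conj_le_iff hp.1]
    refine forall₂_congr fun p _ => ?_
    rw [real_inner_smul_right, le_div_iff₀ ht, sub_mul, mul_comm t⁻¹, mul_assoc,
      inv_mul_cancel₀ ht.ne', mul_one, mul_comm p.2]

/-- A finite sum of suprema is the supremum of the sums. -/
theorem sum_le_coe_iff {ι α : Type*} (B : ι → Set α) (hB : ∀ i, (B i).Nonempty)
    (a : ι → EReal) (g : ι → α → ℝ) (h : ∀ i (c : ℝ), a i ≤ c ↔ ∀ p ∈ B i, g i p ≤ c)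
    (s : Finset ι) : ∀ τ : ℝ, ∑ i ∈ s, a i ≤ τ ↔
      ∀ q : ι → α, (∀ i, q i ∈ B i) → ∑ i ∈ s, g i (q i) ≤ τ := by
  classical
  have hbase : ∃ q : ι → α, ∀ i, q i ∈ B i := ⟨fun i => (hB i).some, fun i => (hB i).some_mem⟩
  obtain ⟨q₀, hq₀⟩ := hbase
  have hge : ∀ i, ∀ p ∈ B i, ((g i p : ℝ) : EReal) ≤ a i := by
    intro i p hp
    by_contra hlt
    obtain ⟨r, hr1, hr2⟩ := EReal.lt_iff_exists_real_btwn.1 (not_le.1 hlt)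
    have := (h i r).1 hr1.le p hp
    exact absurd (EReal.coe_lt_coe_iff.1 hr2) (not_lt.2 this)
  induction s using Finset.induction_on with
  | empty =>
    intro τ
    simp only [Finset.sum_empty]
    exact ⟨fun h _ _ => by exact_mod_cast h, fun h => by exact_mod_cast h q₀ hq₀⟩
  | insert j s hj ih =>
    intro τ
    rw [Finset.sum_insert hj]
    have hlow : ∀ q : ι → α, (∀ i, q i ∈ B i) →
        ((∑ i ∈ s, g i (q i) : ℝ) : EReal) ≤ ∑ i ∈ s, a i := by
      intro q hq
      by_contra hlt
      obtain ⟨r, hr1, hr2⟩ := EReal.lt_iff_exists_real_btwn.1 (not_le.1 hlt)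
      have := (ih r).1 hr1.le q hq
      exact absurd (EReal.coe_lt_coe_iff.1 hr2) (not_lt.2 this)
    constructor
    · intro hle q hq
      rw [Finset.sum_insert hj]
      have := (add_le_add (hge j _ (hq j)) (hlow q hq)).trans hle
      exact_mod_cast this
    · intro hle
      have h1 : ∀ p ∈ B j, ∑ i ∈ s, a i ≤ ((τ - g j p : ℝ) : EReal) := by
        intro p hp
        rw [ih]
        intro q hq
        -- The `j`-th choice varies independently of the others.
        have := hle (Function.update q j p) (fun i => by
          by_cases hi : i = j
          · subst hi; simpa using hp
          · simpa [Function.update_of_ne hi] using hq i)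
        rw [Finset.sum_insert hj, Function.update_self] at this
        have e : ∑ i ∈ s, g i (Function.update q j p i) = ∑ i ∈ s, g i (q i) :=
          Finset.sum_congr rfl fun i hi => by
            rw [Function.update_of_ne (by rintro rfl; exact hj hi)]
        linarith
      have htop : ∑ i ∈ s, a i ≠ ⊤ := fun ht => by
        have := h1 _ (hq₀ j)
        rw [ht] at this
        exact absurd this (not_le.2 (EReal.coe_lt_top _))
      have hbot : ∑ i ∈ s, a i ≠ ⊥ := fun hb => by
        have := hlow q₀ hq₀
        rw [hb] at this
        exact absurd this (by simp)
      lift ∑ i ∈ s, a i to ℝ using ⟨htop, hbot⟩ with b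
      have h2 : a j ≤ ((τ - b : ℝ) : EReal) := (h j _).2 fun p hp => by
        have := EReal.coe_le_coe_iff.1 (h1 p hp)
        linarith
      calc a j + (b : EReal) ≤ ((τ - b : ℝ) : EReal) + b := by gcongr
        _ = τ := by rw [← EReal.coe_add]; simp

end Conjugate

/-! The Lagrangian pairing of primal and dual variables. -/

section Pairing

variable {d m : ℕ}

/-- The pairing of points `(x_i, s_i)` of the epigraphs with the dual variables. -/
def lagr (q : Fin (m + 1) → EuclideanSpace ℝ (Fin d) × ℝ) (z : DualSpace d m) : ℝ :=
  inner ℝ (q 0).1 (z.1 0) - (q 0).2 +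
    ∑ i : Fin m, (inner ℝ (q i.succ).1 (z.1 i.succ) - z.2 i * (q i.succ).2)

theorem lagr_combo (q : Fin (m + 1) → EuclideanSpace ℝ (Fin d) × ℝ) (z z' : DualSpace d m)
    {a b : ℝ} (hab : a + b = 1) : lagr q (a • z + b • z') = a * lagr q z + b * lagr q z' := by
  simp only [lagr, Prod.fst_add, Prod.snd_add, Prod.smul_fst, Prod.smul_snd, Pi.add_apply,
    Pi.smul_apply, inner_add_right, real_inner_smul_right, smul_eq_mul, mul_add, Finset.mul_sum]
  have : ∀ i : Fin m, a * inner ℝ (q i.succ).1 (z.1 i.succ) + b * inner ℝ (q i.succ).1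
      (z'.1 i.succ) - (a * z.2 i + b * z'.2 i) * (q i.succ).2
      = a * (inner ℝ (q i.succ).1 (z.1 i.succ) - z.2 i * (q i.succ).2)
        + b * (inner ℝ (q i.succ).1 (z'.1 i.succ) - z'.2 i * (q i.succ).2) := fun i => by ring
  simp only [this, Finset.sum_add_distrib]
  linear_combination (q 0).2 * hab

variable {f : Fin (m + 1) → EuclideanSpace ℝ (Fin d) → EReal}

/-- The objective term is a perspective with weight `1`. No summand is `⊥`, so negation distributes
over the extended sum. -/
theorem neg_obj_eq (hp : ∀ i, IsProper (f i)) (hc : ∀ i, IsClosedFun (f i))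
    (hf : ∀ i, IsConvexFun (f i)) (z : DualSpace d m) :
    -(dual f).obj z = ∑ i : Fin (m + 1),
      perspective (conj (f i)) (z.1 i) ((Fin.cons 1 z.2 : Fin (m + 1) → ℝ) i) := by
  have hbot : ∀ i, ∀ t : ℝ, perspective (conj (f i)) (z.1 i) t ≠ ⊥ := by
    intro i t h
    obtain ⟨x, hx⟩ := (hp i).2
    obtain ⟨s, hs⟩ := exists_real_ge_of_lt_top hx
    have := (perspective_conj_le_iff (hp i) (hc i) (hf i) (z.1 i) t
      (inner ℝ x (z.1 i) - t * s - 1)).1 (by rw [h]; exact bot_le) (x, s) hs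
    simp only at this
    linarith
  have hsum : ∀ s : Finset (Fin m),
      ∑ i ∈ s, perspective (conj (f i.succ)) (z.1 i.succ) (z.2 i) ≠ ⊥ := by
    intro s
    induction s using Finset.induction_on with
    | empty => simp
    | insert j s hj ih =>
      rw [Finset.sum_insert hj, ← bot_lt_iff_ne_bot, EReal.bot_lt_add_iff]
      exact ⟨bot_lt_iff_ne_bot.2 (hbot _ _), bot_lt_iff_ne_bot.2 ih⟩
  have h0 : perspective (conj (f 0)) (z.1 0) 1 = conj (f 0) (z.1 0) := by
    simp [perspective]
  rw [Fin.sum_univ_succ, Fin.cons_zero, h0]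
  simp only [Fin.cons_succ]
  change -(-conj (f 0) (z.1 0) - _) = _
  have hne : conj (f 0) (z.1 0) ≠ ⊥ := by rw [← h0]; exact hbot 0 1
  rw [EReal.neg_sub (.inr (hsum _)) (.inl (by simpa using hne)), neg_neg]

theorem neg_obj_le_iff (hp : ∀ i, IsProper (f i)) (hc : ∀ i, IsClosedFun (f i))
    (hf : ∀ i, IsConvexFun (f i)) (z : DualSpace d m) (τ : ℝ) :
    -(dual f).obj z ≤ τ ↔ ∀ q, (∀ i, q i ∈ epi (f i)) → lagr q z ≤ τ := by
  have hne : ∀ i, (epi (f i)).Nonempty := fun i => by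
    obtain ⟨x, hx⟩ := (hp i).2
    obtain ⟨s, hs⟩ := exists_real_ge_of_lt_top hx
    exact ⟨(x, s), hs⟩
  rw [neg_obj_eq hp hc hf, sum_le_coe_iff (fun i => epi (f i)) hne _
    (fun i p => inner ℝ p.1 (z.1 i) - (Fin.cons 1 z.2 : Fin (m + 1) → ℝ) i * p.2)
    (fun i c => perspective_conj_le_iff (hp i) (hc i) (hf i) _ _ c)]
  refine forall₂_congr fun q _ => ?_
  rw [Fin.sum_univ_succ, lagr]
  simp only [Fin.cons_zero, Fin.cons_succ, one_mul]

theorem exists_epi (hp : ∀ i, IsProper (f i)) :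
    ∃ q : Fin (m + 1) → EuclideanSpace ℝ (Fin d) × ℝ, ∀ i, q i ∈ epi (f i) := by
  choose x hx using fun i => (hp i).2
  choose s hs using fun i => exists_real_ge_of_lt_top (hx i)
  exact ⟨fun i => (x i, s i), hs⟩

theorem isConvexFun_neg_obj (hp : ∀ i, IsProper (f i)) (hc : ∀ i, IsClosedFun (f i))
    (hf : ∀ i, IsConvexFun (f i)) : IsConvexFun fun z => -(dual f).obj z := by
  rintro ⟨z, s⟩ hz ⟨z', s'⟩ hz' a b ha hb hab
  have hz := (neg_obj_le_iff hp hc hf z s).1 hz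
  have hz' := (neg_obj_le_iff hp hc hf z' s').1 hz'
  refine (neg_obj_le_iff hp hc hf (a • z + b • z') (a * s + b * s')).2 fun q hq => ?_
  rw [lagr_combo q z z' hab]
  exact add_le_add (mul_le_mul_of_nonneg_left (hz q hq) ha)
    (mul_le_mul_of_nonneg_left (hz' q hq) hb)

theorem lagr_add_single (q : Fin (m + 1) → EuclideanSpace ℝ (Fin d) × ℝ) (z : DualSpace d m)
    (k : Fin m) (t : ℝ) :
    lagr (q + Pi.single k.succ (0, t)) z = lagr q z - z.2 k * t := by
  set p : Fin (m + 1) → EuclideanSpace ℝ (Fin d) × ℝ := Pi.single k.succ (0, t)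
  have h0 : p 0 = 0 :=
    Pi.single_eq_of_ne (Fin.succ_ne_zero k).symm _
  have h1 : ∀ i : Fin m, p i.succ = if i = k then (0, t) else 0 := by
    intro i
    by_cases h : i = k
    · subst h; simp [p]
    · rw [if_neg h]; exact Pi.single_eq_of_ne (by simpa using h) _
  have h2 : ∀ i : Fin m, inner ℝ (q i.succ + p i.succ).1 (z.1 i.succ)
      - z.2 i * (q i.succ + p i.succ).2
      = (inner ℝ (q i.succ).1 (z.1 i.succ) - z.2 i * (q i.succ).2)
        - if i = k then z.2 k * t else 0 := by
    intro i
    rw [h1]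
    split_ifs with h
    · subst h; simp; ring
    · simp
  simp only [lagr, Pi.add_apply, h2, Finset.sum_sub_distrib, h0, add_zero, Finset.sum_ite_eq',
    Finset.mem_univ, if_true]
  ring

/-- Raising the `k`-th height stays in the epigraph and changes `lagr` by `-z.2 k * t`, so a
negative multiplier would make it unbounded. The constraint on the multipliers is therefore implicit
in the domain of the dual objective. -/
theorem nonneg_of_neg_obj_le (hp : ∀ i, IsProper (f i)) (hc : ∀ i, IsClosedFun (f i))
    (hf : ∀ i, IsConvexFun (f i)) {z : DualSpace d m} {τ : ℝ} (h : -(dual f).obj z ≤ τ)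
    (k : Fin m) : 0 ≤ z.2 k := by
  obtain ⟨q, hq⟩ := exists_epi hp
  by_contra hneg
  push Not at hneg
  set t := (|τ - lagr q z| + 1) / (-z.2 k) with ht
  have hz : 0 < -z.2 k := by linarith
  have ht0 : 0 ≤ t := by positivity
  have htm : (-z.2 k) * t = |τ - lagr q z| + 1 := mul_div_cancel₀ _ hz.ne'
  have := (neg_obj_le_iff hp hc hf z τ).1 h (q + Pi.single k.succ (0, t)) (fun i => by
    by_cases hi : i = k.succ
    · subst hi
      have h1 : f k.succ (q k.succ).1 ≤ ((q k.succ).2 : EReal) := hq _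
      rw [Pi.add_apply]
      change f k.succ (q k.succ + _).1 ≤ ((q k.succ + _).2 : ℝ)
      simp only [Pi.single_eq_same, Prod.fst_add, Prod.snd_add, add_zero]
      exact h1.trans (EReal.coe_le_coe_iff.2 (by linarith))
    · rw [Pi.add_apply, Pi.single_eq_of_ne hi, add_zero]; exact hq i)
  rw [lagr_add_single] at this
  have := le_abs_self (τ - lagr q z)
  linarith

theorem mem_dual_carrier_iff (z : DualSpace d m) :
    z ∈ (dual f).carrier ↔ (∀ i, 0 ≤ z.2 i) ∧ ∑ i, z.1 i = 0 := by
  have h1 : ∀ i : Fin m, ((dual f).ineqFun i z ≤ 0 ↔ 0 ≤ z.2 i) := fun i => by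
    change ((-(z.2 i) : ℝ) : EReal) ≤ 0 ↔ _
    rw [← EReal.coe_zero, EReal.coe_le_coe_iff]; constructor <;> intro h <;> linarith
  have h2 : (∀ j : Fin d, (dual f).eqFun j z = 0) ↔ ∑ i, z.1 i = 0 := by
    rw [PiLp.ext_iff]
    refine forall_congr' fun j => ?_
    change ((∑ i, z.1 i j : ℝ) : EReal) = 0 ↔ _
    rw [← EReal.coe_zero, EReal.coe_eq_coe_iff]
    simp
  exact and_congr (forall_congr' h1) h2

theorem mem_primal_carrier_iff (x : EuclideanSpace ℝ (Fin d)) :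
    x ∈ (primal f).carrier ↔ ∀ i : Fin m, f i.succ x ≤ 0 :=
  ⟨fun h => h.1, fun h => ⟨h, fun j => j.elim⟩⟩

/-- Evaluate `lagr` at the common point `x` with constraint heights `0`, where the multipliers drop
out. This is weak duality before `∑ i, w_i = 0` is imposed. -/
theorem sum_inner_le (hp : ∀ i, IsProper (f i)) (hc : ∀ i, IsClosedFun (f i))
    (hf : ∀ i, IsConvexFun (f i)) {x : EuclideanSpace ℝ (Fin d)} (hx : ∀ i : Fin m, f i.succ x ≤ 0)
    {r : ℝ} (hr : f 0 x ≤ r) {z : DualSpace d m} {τ : ℝ} (hz : -(dual f).obj z ≤ τ) :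
    ∑ i, inner ℝ x (z.1 i) ≤ r + τ := by
  have := (neg_obj_le_iff hp hc hf z τ).1 hz (Fin.cons (x, r) fun _ => (x, 0)) (fun i => by
    induction i using Fin.cases with
    | zero => exact hr
    | succ i => exact hx i)
  rw [Fin.sum_univ_succ]
  simp [lagr] at this
  linarith

/-- A bound on the linear forms `z ↦ ∑ i, ⟨x, w_i⟩` by the dual objective forces `x` to be
feasible for the primal problem. -/
theorem primal_of_sum_inner_le (hp : ∀ i, IsProper (f i)) (hc : ∀ i, IsClosedFun (f i))
    (hf : ∀ i, IsConvexFun (f i)) {x : EuclideanSpace ℝ (Fin d)} {C : ℝ}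
    (h : ∀ (z : DualSpace d m) (τ : ℝ), -(dual f).obj z ≤ τ → ∑ i, inner ℝ x (z.1 i) ≤ C + τ) :
    f 0 x ≤ C ∧ ∀ i : Fin m, f i.succ x ≤ 0 := by
  constructor
  · refine (mem_epi_iff (hp 0) (hc 0) (hf 0) (x, C)).2 fun w c hw => ?_
    have := h (Pi.single 0 w, 0) c ((neg_obj_le_iff hp hc hf _ _).2 fun q hq => by
      have := (conj_le_iff (hp 0).1 w c).1 hw _ (hq 0)
      simpa [lagr] using this)
    rw [Fin.sum_univ_succ] at this
    simp at this
    simp only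
    linarith
  · intro k
    refine (mem_epi_iff (hp _) (hc _) (hf _) (x, 0)).2 fun w c hw => ?_
    obtain ⟨w₀, c₀, hw₀⟩ := exists_conj_le (hp 0) (hc 0) (hf 0)
    -- The dual points with `w_k = t w` and `k`-th multiplier `t` form a ray; letting `t` grow
    -- leaves `⟨x, w⟩ ≤ c`.
    have key : ∀ t : ℝ, 0 ≤ t → inner ℝ x w₀ + t * inner ℝ x w ≤ C + (c₀ + t * c) := by
      intro t ht
      have := h (Fin.cons w₀ (Pi.single k (t • w)), Pi.single k t) (c₀ + t * c)
        ((neg_obj_le_iff hp hc hf _ _).2 fun q hq => by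
          have h0 := (conj_le_iff (hp 0).1 w₀ c₀).1 hw₀ _ (hq 0)
          have h1 := mul_le_mul_of_nonneg_left
            ((conj_le_iff (hp _).1 w c).1 hw _ (hq k.succ)) ht
          rw [lagr, Finset.sum_eq_single k]
          · simp [real_inner_smul_right]
            linarith
          · intro i _ hi
            simp [hi]
          · simp)
      rw [Fin.sum_univ_succ, Finset.sum_eq_single k] at this
      · simpa [real_inner_smul_right] using this
      · intro i _ hi
        simp [hi]
      · simp
    simp only [sub_zero]
    by_contra hlt
    push Not at hlt
    have hd : 0 < inner ℝ x w - c := by linarith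
    set K := C + c₀ - inner ℝ x w₀
    have h1 := key ((|K| + 1) / (inner ℝ x w - c)) (by positivity)
    have h2 : (|K| + 1) / (inner ℝ x w - c) * (inner ℝ x w - c) = |K| + 1 :=
      div_mul_cancel₀ _ hd.ne'
    have h3 := le_abs_self K
    nlinarith

end Pairing

/-! Strong duality from core points, and core points from bounded feasible regions. -/

section Strong

variable {d m : ℕ}

theorem exists_inner_eq {E : Type*} [NormedAddCommGroup E] [InnerProductSpace ℝ E]
    [FiniteDimensional ℝ E] (φ : E →ₗ[ℝ] ℝ) : ∃ y : E, ∀ v, φ v = inner ℝ y v :=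
  ⟨(InnerProductSpace.toDual ℝ E).symm (LinearMap.toContinuousLinearMap φ), fun v => by
    rw [InnerProductSpace.toDual_symm_apply]; rfl⟩

theorem exists_sum_inner_eq {E : Type*} [NormedAddCommGroup E] [InnerProductSpace ℝ E]
    [FiniteDimensional ℝ E] (φ : (Fin m → E) →ₗ[ℝ] ℝ) :
    ∃ y : Fin m → E, ∀ v, φ v = ∑ i, inner ℝ (v i) (y i) := by
  choose y hy using fun i => exists_inner_eq (φ.comp (LinearMap.single ℝ (fun _ => E) i))
  refine ⟨y, fun v => ?_⟩
  conv_lhs => rw [← Finset.univ_sum_single v, map_sum]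
  exact Finset.sum_congr rfl fun i _ => by rw [real_inner_comm, ← hy]; rfl

theorem eq_zero_of_isBounded_ray {V : Type*} [NormedAddCommGroup V] [NormedSpace ℝ V]
    {F : Set V} (hF : Bornology.IsBounded F) {z δ : V} (h : ∀ t : ℝ, 0 ≤ t → z + t • δ ∈ F) :
    δ = 0 := by
  obtain ⟨R, hR⟩ := hF.exists_norm_le
  by_contra hδ
  have hpos : 0 < ‖δ‖ := norm_pos_iff.2 hδ
  have hR0 : 0 ≤ R := (norm_nonneg _).trans (hR _ (h 0 le_rfl))
  set t := (R + ‖z‖ + 1) / ‖δ‖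
  have ht : 0 ≤ t := by positivity
  have h1 := hR _ (h t ht)
  have h2 : ‖t • δ‖ = R + ‖z‖ + 1 := by
    rw [norm_smul, Real.norm_of_nonneg ht]; exact div_mul_cancel₀ _ hpos.ne'
  have h3 : ‖t • δ‖ ≤ ‖z + t • δ‖ + ‖z‖ := by
    have := norm_sub_le (z + t • δ) z
    simpa using this
  linarith

/-- The sum of the first components of the dual variables. -/
def sumMap (d m : ℕ) : DualSpace d m →ₗ[ℝ] EuclideanSpace ℝ (Fin d) :=
  (∑ i, LinearMap.proj i) ∘ₗ LinearMap.fst ℝ _ _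

theorem sumMap_apply (z : DualSpace d m) : sumMap d m z = ∑ i, z.1 i := by
  simp [sumMap]

/-- The differences `x_i - x_0` of the primal variables. -/
def diffMap (d m : ℕ) : (Fin (m + 1) → EuclideanSpace ℝ (Fin d) × ℝ) →ₗ[ℝ]
    (Fin m → EuclideanSpace ℝ (Fin d)) where
  toFun q i := (q i.succ).1 - (q 0).1
  map_add' q q' := by ext1 i; simp only [Pi.add_apply, Prod.fst_add]; abel
  map_smul' t q := by ext1 i; simp [smul_sub]

theorem diffMap_apply (q : Fin (m + 1) → EuclideanSpace ℝ (Fin d) × ℝ) (i : Fin m) :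
    diffMap d m q i = (q i.succ).1 - (q 0).1 := rfl

/-- The values `s_i` of the constraints. -/
def slackMap (d m : ℕ) : (Fin (m + 1) → EuclideanSpace ℝ (Fin d) × ℝ) →ₗ[ℝ] (Fin m → ℝ) where
  toFun q i := (q i.succ).2
  map_add' _ _ := rfl
  map_smul' _ _ := rfl

theorem slackMap_apply (q : Fin (m + 1) → EuclideanSpace ℝ (Fin d) × ℝ) (i : Fin m) :
    slackMap d m q i = (q i.succ).2 := rfl

/-- The dual variables `(∑ y_i, -y_1, …, -y_m; μ)`, which satisfy the equality constraints. -/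
def dualPoint (y : Fin m → EuclideanSpace ℝ (Fin d)) (μ : Fin m → ℝ) : DualSpace d m :=
  (Fin.cons (∑ i, y i) (-y), μ)

theorem sum_dualPoint (y : Fin m → EuclideanSpace ℝ (Fin d)) (μ : Fin m → ℝ) :
    ∑ i, (dualPoint y μ).1 i = 0 := by
  rw [Fin.sum_univ_succ]
  simp [dualPoint]

theorem lagr_add_smul_dualPoint (q : Fin (m + 1) → EuclideanSpace ℝ (Fin d) × ℝ)
    (z : DualSpace d m) (t : ℝ) (y : Fin m → EuclideanSpace ℝ (Fin d)) (μ : Fin m → ℝ) :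
    lagr q (z + t • dualPoint y μ) = lagr q z -
      t * (∑ i, inner ℝ (diffMap d m q i) (y i) + ∑ i, μ i * slackMap d m q i) := by
  simp only [lagr, dualPoint, diffMap_apply, slackMap_apply, Prod.fst_add, Prod.snd_add,
    Prod.smul_fst, Prod.smul_snd, Pi.add_apply, Pi.smul_apply, Fin.cons_zero, Fin.cons_succ,
    inner_add_right, real_inner_smul_right, inner_sum, Pi.neg_apply, inner_neg_right,
    inner_sub_left, smul_eq_mul, add_mul, Finset.sum_add_distrib, Finset.sum_sub_distrib,
    mul_add, mul_sub, Finset.mul_sum, mul_neg, Finset.sum_neg_distrib, mul_assoc]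
  ring

theorem lagr_dualPoint (q : Fin (m + 1) → EuclideanSpace ℝ (Fin d) × ℝ)
    (y : Fin m → EuclideanSpace ℝ (Fin d)) (μ : Fin m → ℝ) :
    lagr q (dualPoint y μ) = -(q 0).2 -
      (∑ i, inner ℝ (diffMap d m q i) (y i) + ∑ i, μ i * slackMap d m q i) := by
  have := lagr_add_smul_dualPoint q 0 1 y μ
  rw [one_smul, zero_add, one_mul] at this
  rw [this]
  simp [lagr]

variable {f : Fin (m + 1) → EuclideanSpace ℝ (Fin d) → EReal}

/-- `farkas_eq` is applied to the product of the `S i`. These may be smaller than the epigraphs, to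
allow graphs of affine constraints; `hlow` and the nonnegative multipliers carry the inequality back
to the epigraphs. -/
theorem dual_exists_of_isRelCore (hp : ∀ i, IsProper (f i)) (hc : ∀ i, IsClosedFun (f i))
    (hf : ∀ i, IsConvexFun (f i)) {S : Fin (m + 1) → Set (EuclideanSpace ℝ (Fin d) × ℝ)}
    (hS : ∀ i, Convex ℝ (S i)) (hsub : ∀ i, S i ⊆ epi (f i))
    (hlow : ∀ i, ∀ p ∈ epi (f i), ∃ p' ∈ S i, p'.1 = p.1 ∧ p'.2 ≤ p.2)
    {q₀ : Fin (m + 1) → EuclideanSpace ℝ (Fin d) × ℝ} (hq₀ : IsRelCore (Set.univ.pi S) q₀)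
    (hdiff : diffMap d m q₀ = 0) (hslack : ∀ i, slackMap d m q₀ i ≤ 0) {c : ℝ}
    (hval : ∀ x ∈ (primal f).carrier, (c : EReal) ≤ f 0 x) :
    ∃ z ∈ (dual f).carrier, (c : EReal) ≤ (dual f).obj z := by
  let V := Fin (m + 1) → EuclideanSpace ℝ (Fin d) × ℝ
  let b : V →ᵃ[ℝ] ℝ :=
    (LinearMap.snd ℝ _ _ ∘ₗ LinearMap.proj 0).toAffineMap - AffineMap.const ℝ V c
  have hb : ∀ q, b q = (q 0).2 - c := fun _ => rfl
  obtain ⟨μ, φ, hμ, h⟩ := farkas_eq (convex_pi fun i _ => hS i) hq₀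
    (fun i => (LinearMap.proj i ∘ₗ slackMap d m).toAffineMap) (fun i => hslack i)
    (diffMap d m) hdiff b (by
      intro q hq hs hT
      have hx : ∀ i : Fin m, (q i.succ).1 = (q 0).1 := fun i => by
        have := congrFun hT i
        rwa [diffMap_apply, Pi.zero_apply, sub_eq_zero] at this
      have hmem : (q 0).1 ∈ (primal f).carrier := (mem_primal_carrier_iff _).2 fun i => by
        have h1 : f i.succ (q i.succ).1 ≤ ((q i.succ).2 : EReal) := hsub _ (hq i.succ trivial)
        rw [hx] at h1
        refine h1.trans ?_
        have := hs i
        simp only [LinearMap.coe_toAffineMap, LinearMap.comp_apply, LinearMap.proj_apply,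
          slackMap_apply] at this
        exact_mod_cast this
      have h2 : f 0 (q 0).1 ≤ ((q 0).2 : EReal) := hsub _ (hq 0 trivial)
      have := EReal.coe_le_coe_iff.1 ((hval _ hmem).trans h2)
      rw [hb]; linarith)
  obtain ⟨y, hy⟩ := exists_sum_inner_eq φ
  refine ⟨dualPoint y μ, (mem_dual_carrier_iff _).2 ⟨hμ, sum_dualPoint y μ⟩, ?_⟩
  have hle : -(dual f).obj (dualPoint y μ) ≤ ((-c : ℝ) : EReal) := by
    refine (neg_obj_le_iff hp hc hf _ _).2 fun q hq => ?_
    choose q' hq'S hq'1 hq'2 using fun i => hlow i (q i) (hq i)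
    have h1 := h q' (fun i _ => hq'S i)
    rw [hb, hy] at h1
    simp only [LinearMap.coe_toAffineMap, LinearMap.comp_apply, LinearMap.proj_apply] at h1
    rw [lagr_dualPoint]
    have h2 : diffMap d m q' = diffMap d m q := by
      ext1 i; simp only [diffMap_apply, hq'1]
    rw [h2] at h1
    have h3 : ∑ i, μ i * slackMap d m q' i ≤ ∑ i, μ i * slackMap d m q i :=
      Finset.sum_le_sum fun i _ => mul_le_mul_of_nonneg_left (by
        rw [slackMap_apply, slackMap_apply]; exact hq'2 _) (hμ i)
    have h4 := hq'2 0
    linarith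
  rw [EReal.coe_neg] at hle
  exact EReal.neg_le_neg_iff.1 hle

/-- Only the equation `∑ i, w_i = 0` needs a multiplier, since membership in the domain already
forces the signs; hence the empty index type. The negated multiplier is the primal solution. -/
theorem primal_exists_of_isRelCore (hp : ∀ i, IsProper (f i)) (hc : ∀ i, IsClosedFun (f i))
    (hf : ∀ i, IsConvexFun (f i)) {z₀ : DualSpace d m}
    (hz₀ : IsRelCore (dom fun z => -(dual f).obj z) z₀) (hsum : sumMap d m z₀ = 0) {c : ℝ}
    (hval : ∀ z ∈ (dual f).carrier, (dual f).obj z ≤ c) :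
    ∃ x ∈ (primal f).carrier, f 0 x ≤ c := by
  obtain ⟨t, ht, -⟩ := EReal.lt_iff_exists_real_btwn.1 hz₀.1
  have hconv := isConvexFun_neg_obj hp hc hf
  let b : DualSpace d m × ℝ →ᵃ[ℝ] ℝ :=
    (LinearMap.snd ℝ _ _).toAffineMap + AffineMap.const ℝ _ c
  have hb : ∀ v, b v = v.2 + c := fun v => by simp [b]
  obtain ⟨μ, φ, _, h⟩ := farkas_eq (ι := Empty) (S := epi fun z => -(dual f).obj z) hconv
    (isRelCore_epi hconv hz₀ ht) (fun i => i.elim) (fun i => i.elim)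
    (sumMap d m ∘ₗ LinearMap.fst ℝ _ _) hsum b (by
      rintro ⟨z, τ⟩ hz - hT
      have hz : -(dual f).obj z ≤ (τ : EReal) := hz
      have hmem : z ∈ (dual f).carrier := (mem_dual_carrier_iff z).2
        ⟨nonneg_of_neg_obj_le hp hc hf hz, by rw [← sumMap_apply]; exact hT⟩
      have h1 : -(c : EReal) ≤ τ := (EReal.neg_le_neg_iff.2 (hval z hmem)).trans hz
      rw [← EReal.coe_neg, EReal.coe_le_coe_iff] at h1
      rw [hb]; linarith)
  obtain ⟨y, hy⟩ := exists_inner_eq φ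
  obtain ⟨h1, h2⟩ := primal_of_sum_inner_le hp hc hf (x := -y) (C := c) fun z τ hz => by
    have h1 := h (z, τ) hz
    rw [hb, hy] at h1
    simp only [LinearMap.comp_apply, LinearMap.fst_apply, sumMap_apply] at h1
    rw [inner_sum] at h1
    simp only [inner_neg_left, Finset.sum_neg_distrib]
    simp at h1
    linarith
  exact ⟨-y, (mem_primal_carrier_iff _).2 h2, h1⟩

theorem exists_isRelCore_of_isBounded_primal (hp : ∀ i, IsProper (f i))
    (hc : ∀ i, IsClosedFun (f i)) (hf : ∀ i, IsConvexFun (f i))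
    (hne : (primal f).feasibleRegion.Nonempty)
    (hbd : Bornology.IsBounded (primal f).feasibleRegion) :
    ∃ z₀, IsRelCore (dom fun z => -(dual f).obj z) z₀ ∧ sumMap d m z₀ = 0 := by
  obtain ⟨x, hx, hxt⟩ := hne
  have hx' := (mem_primal_carrier_iff x).1 hx
  obtain ⟨r, hr⟩ := exists_real_ge_of_lt_top (lt_top_iff_ne_top.2 hxt)
  refine exists_isRelCore_of_map_eq_zero (convex_dom (isConvexFun_neg_obj hp hc hf)) ?_ _ ?_
  · obtain ⟨w, c, hw⟩ := exists_conj_le (hp 0) (hc 0) (hf 0)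
    have : -(dual f).obj (Pi.single 0 w, 0) ≤ (c : EReal) :=
      (neg_obj_le_iff hp hc hf _ _).2 fun q hq => by
        have := (conj_le_iff (hp 0).1 w c).1 hw _ (hq 0)
        simpa [lagr] using this
    exact ⟨_, lt_of_le_of_lt this (EReal.coe_lt_top _)⟩
  · intro φ hφ
    by_contra hcon
    push Not at hcon
    obtain ⟨y, hy⟩ := exists_inner_eq φ
    refine hφ (LinearMap.ext fun v => ?_)
    -- If `⟨y, ·⟩` is nonpositive on the image of the dual domain, moving `x` along `y` preserves
    -- the bounds that characterize primal feasibility.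
    have hy0 : y = 0 := eq_zero_of_isBounded_ray hbd (z := x) fun t ht => by
      obtain ⟨h1, h2⟩ := primal_of_sum_inner_le hp hc hf (x := x + t • y) (C := r) fun z τ hz => by
        have h1 := sum_inner_le hp hc hf hx' hr hz
        have h2 := hcon z (lt_of_le_of_lt hz (EReal.coe_lt_top _))
        rw [hy, sumMap_apply, inner_sum] at h2
        simp only [inner_add_left, real_inner_smul_left, Finset.sum_add_distrib, ← Finset.mul_sum]
        nlinarith
      exact ⟨(mem_primal_carrier_iff _).2 h2, (lt_of_le_of_lt h1 (EReal.coe_lt_top _)).ne⟩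
    rw [hy, hy0, inner_zero_left, LinearMap.zero_apply]

theorem exists_isRelCore_of_isBounded_dual (hp : ∀ i, IsProper (f i))
    (hc : ∀ i, IsClosedFun (f i)) (hf : ∀ i, IsConvexFun (f i))
    (hne : (dual f).feasibleRegion.Nonempty)
    (hbd : Bornology.IsBounded (dual f).feasibleRegion) :
    ∃ q₀, IsRelCore (Set.univ.pi fun i => epi (f i)) q₀ ∧ diffMap d m q₀ = 0 ∧
      slackMap d m q₀ = 0 := by
  obtain ⟨z, hz, hzb⟩ := hne
  have hz' := (mem_dual_carrier_iff z).1 hz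
  obtain ⟨τ, hτ⟩ := exists_real_ge_of_lt_top (a := -(dual f).obj z) (by
    rw [lt_top_iff_ne_top]; simpa using hzb)
  obtain ⟨q, hq⟩ := exists_epi hp
  obtain ⟨q₀, h1, h2⟩ := exists_isRelCore_of_map_eq_zero (convex_pi fun i _ => hf i)
    ⟨q, fun i _ => hq i⟩ ((diffMap d m).prod (slackMap d m)) (by
      intro φ hφ
      by_contra hcon
      push Not at hcon
      obtain ⟨y, hy⟩ := exists_sum_inner_eq (φ.comp (LinearMap.inl ℝ _ _))
      obtain ⟨μ, hμ⟩ := exists_sum_inner_eq (φ.comp (LinearMap.inr ℝ _ _))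
      have hsplit : ∀ u s, φ (u, s) = ∑ i, inner ℝ (u i) (y i) + ∑ i, μ i * s i := by
        intro u s
        have h1 : φ (u, s) = φ (u, 0) + φ (0, s) := by rw [← map_add]; simp
        have h2 : φ (u, 0) = _ := hy u
        have h3 : φ (0, s) = _ := hμ s
        rw [h1, h2, h3]
        simp
      -- Nonpositivity of `φ` on the epigraphs says that `lagr` does not increase in this direction.
      have hzero : dualPoint (-y) (-μ) = 0 :=
        eq_zero_of_isBounded_ray hbd (z := z) fun t ht => by
          have hle : -(dual f).obj (z + t • dualPoint (-y) (-μ)) ≤ (τ : EReal) :=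
            (neg_obj_le_iff hp hc hf _ _).2 fun q hq => by
              have e1 := (neg_obj_le_iff hp hc hf _ _).1 hτ q hq
              have e2 := hcon q (fun i _ => hq i)
              change φ (diffMap d m q, slackMap d m q) ≤ 0 at e2
              rw [hsplit] at e2
              rw [lagr_add_smul_dualPoint]
              simp only [Pi.neg_apply, inner_neg_right, neg_mul, Finset.sum_neg_distrib]
              nlinarith
          refine ⟨(mem_dual_carrier_iff _).2 ⟨nonneg_of_neg_obj_le hp hc hf hle, ?_⟩, ?_⟩
          · have : ∑ i, (z + t • dualPoint (-y) (-μ)).1 i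
                = ∑ i, z.1 i + t • ∑ i, (dualPoint (-y) (-μ)).1 i := by
              simp [Finset.sum_add_distrib, Finset.smul_sum]
            rw [this, hz'.2, sum_dualPoint, smul_zero, add_zero]
          · intro hbot
            rw [hbot] at hle
            exact absurd hle (by simp)
      have hy0 : y = 0 := by
        ext1 i
        have := congrFun (congrArg Prod.fst hzero) i.succ
        simpa [dualPoint] using this
      have hμ0 : μ = 0 := by
        have := congrArg Prod.snd hzero
        simpa [dualPoint] using this
      refine hφ (LinearMap.ext fun v => ?_)
      rw [hsplit v.1 v.2, hy0, hμ0]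
      simp)
  exact ⟨q₀, h1, congrArg Prod.fst h2, congrArg Prod.snd h2⟩

theorem dual_value_le_primal_value (hp : ∀ i, IsProper (f i)) (hc : ∀ i, IsClosedFun (f i))
    (hf : ∀ i, IsConvexFun (f i)) : (dual f).value ≤ (primal f).value := by
  refine iSup₂_le fun z hz => le_iInf₂ fun x hx => ?_
  change (dual f).obj z ≤ f 0 x
  by_contra hlt
  obtain ⟨r, hr1, hr2⟩ := EReal.lt_iff_exists_real_btwn.1 (not_le.1 hlt)
  obtain ⟨s, hs1, hs2⟩ := EReal.lt_iff_exists_real_btwn.1 hr2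
  have h1 : -(dual f).obj z ≤ ((-s : ℝ) : EReal) := by
    rw [EReal.coe_neg]; exact EReal.neg_le_neg_iff.2 hs2.le
  have h2 := sum_inner_le hp hc hf ((mem_primal_carrier_iff x).1 hx) hr1.le h1
  rw [← inner_sum, ((mem_dual_carrier_iff z).1 hz).2, inner_zero_right] at h2
  have := EReal.coe_lt_coe_iff.1 hs1
  linarith

/-- Taking `c` to be the finite infimum itself gives equality and attainment at once. If the infimum
is `⊥`, weak duality makes the dual infeasible, hence solvable by convention. -/
theorem strong_duality_dual_solvable (hp : ∀ i, IsProper (f i)) (hc : ∀ i, IsClosedFun (f i))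
    (hf : ∀ i, IsConvexFun (f i)) (hfeas : ∃ x ∈ (primal f).carrier, f 0 x < ⊤)
    (h : ∀ c : ℝ, (∀ x ∈ (primal f).carrier, (c : EReal) ≤ f 0 x) →
      ∃ z ∈ (dual f).carrier, (c : EReal) ≤ (dual f).obj z) :
    (primal f).value = (dual f).value ∧ (dual f).Solvable := by
  have hweak := dual_value_le_primal_value hp hc hf
  have hle : ∀ x ∈ (primal f).carrier, (primal f).value ≤ f 0 x := fun x hx => iInf₂_le x hx
  have hge : ∀ z ∈ (dual f).carrier, (dual f).obj z ≤ (dual f).value :=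
    fun z hz => le_iSup₂ (f := fun z (_ : z ∈ (dual f).carrier) => (dual f).obj z) z hz
  induction hv : (primal f).value with
  | bot =>
    rw [hv] at hweak
    have hbot : (dual f).value = ⊥ := le_bot_iff.1 hweak
    refine ⟨hbot.symm, 0, .inr (Set.eq_empty_iff_forall_notMem.2 fun z hz => hz.2 ?_)⟩
    exact le_bot_iff.1 (hbot ▸ hge z hz.1)
  | top =>
    obtain ⟨x, hx, hlt⟩ := hfeas
    exact absurd (hv ▸ hle x hx) (not_le.2 hlt)
  | coe c =>
    obtain ⟨z, hz, hcz⟩ := h c (fun x hx => hv ▸ hle x hx)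
    have heq : (c : EReal) = (dual f).value :=
      le_antisymm (hcz.trans (hge z hz)) (hv ▸ hweak)
    have hobj : (dual f).obj z = (dual f).value := le_antisymm (hge z hz) (heq ▸ hcz)
    refine ⟨heq, z, .inl ⟨⟨hz, ?_⟩, hobj⟩⟩
    rw [hobj, ← heq]; exact EReal.coe_ne_bot c

theorem strong_duality_primal_solvable (hp : ∀ i, IsProper (f i)) (hc : ∀ i, IsClosedFun (f i))
    (hf : ∀ i, IsConvexFun (f i)) {z₀ : DualSpace d m}
    (hz₀ : IsRelCore (dom fun z => -(dual f).obj z) z₀) (hsum : sumMap d m z₀ = 0) :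
    (primal f).value = (dual f).value ∧ (primal f).Solvable := by
  have hweak := dual_value_le_primal_value hp hc hf
  have hle : ∀ x ∈ (primal f).carrier, (primal f).value ≤ f 0 x := fun x hx => iInf₂_le x hx
  have hge : ∀ z ∈ (dual f).carrier, (dual f).obj z ≤ (dual f).value :=
    fun z hz => le_iSup₂ (f := fun z (_ : z ∈ (dual f).carrier) => (dual f).obj z) z hz
  induction hv : (dual f).value with
  | bot =>
    obtain ⟨τ, hτ⟩ := exists_real_ge_of_lt_top hz₀.1
    have hmem : z₀ ∈ (dual f).carrier := (mem_dual_carrier_iff z₀).2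
      ⟨nonneg_of_neg_obj_le hp hc hf hτ, by rw [← sumMap_apply]; exact hsum⟩
    have hbot : (dual f).obj z₀ = ⊥ := le_bot_iff.1 (hv ▸ hge z₀ hmem)
    have := hz₀.1
    simp [dom, hbot] at this
  | top =>
    rw [hv] at hweak
    have htop : (primal f).value = ⊤ := top_le_iff.1 hweak
    refine ⟨htop, 0, .inr (Set.eq_empty_iff_forall_notMem.2 fun x hx => hx.2 ?_)⟩
    exact top_le_iff.1 (htop ▸ hle x hx.1)
  | coe c =>
    obtain ⟨x, hx, hxc⟩ := primal_exists_of_isRelCore hp hc hf hz₀ hsum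
      (fun z hz => hv ▸ hge z hz)
    have heq : (primal f).value = (c : EReal) :=
      le_antisymm ((hle x hx).trans hxc) (hv ▸ hweak)
    have hobj : f 0 x = (primal f).value := le_antisymm (heq ▸ hxc) (hle x hx)
    refine ⟨heq, x, .inl ⟨⟨hx, ?_⟩, hobj⟩⟩
    change f 0 x ≠ ⊤
    rw [hobj, heq]; exact EReal.coe_ne_top c

theorem dual_exists_of_isSlaterPoint (hp : ∀ i, IsProper (f i)) (hc : ∀ i, IsClosedFun (f i))
    (hf : ∀ i, IsConvexFun (f i)) {x : EuclideanSpace ℝ (Fin d)}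
    (hx : (primal f).IsSlaterPoint x) {c : ℝ}
    (hval : ∀ x ∈ (primal f).carrier, (c : EReal) ≤ f 0 x) :
    ∃ z ∈ (dual f).carrier, (c : EReal) ≤ (dual f).obj z := by
  have key : ∀ i, ∃ (S : Set (EuclideanSpace ℝ (Fin d) × ℝ)) (s : ℝ), Convex ℝ S ∧
      S ⊆ epi (f i) ∧ (∀ p ∈ epi (f i), ∃ p' ∈ S, p'.1 = p.1 ∧ p'.2 ≤ p.2) ∧
      IsRelCore S (x, s) ∧ (i ≠ 0 → s ≤ 0) := by
    intro i
    induction i using Fin.cases with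
    | zero =>
      have hcore := isRelCore_of_mem_intrinsicInterior hx.2
      obtain ⟨s, hs, -⟩ := EReal.lt_iff_exists_real_btwn.1 hcore.1
      exact ⟨_, s, hf 0, subset_rfl, fun p hp => ⟨p, hp, rfl, le_rfl⟩,
        isRelCore_epi (hf 0) hcore hs, fun h => absurd rfl h⟩
    | succ i =>
      have hcore := isRelCore_of_mem_intrinsicInterior (hx.1.mem_ri_ineq i)
      by_cases hlin : IsLinearFun (f i.succ)
      · obtain ⟨g, hg⟩ := hlin
        refine ⟨_, g x, convex_graph g, ?_, ?_, isRelCore_graph g x, fun _ => ?_⟩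
        · rintro ⟨y, s⟩ hy
          change s = g y at hy
          change f i.succ y ≤ (s : EReal)
          rw [hg, hy]
        · rintro ⟨y, s⟩ hy
          change f i.succ y ≤ (s : EReal) at hy
          rw [hg, EReal.coe_le_coe_iff] at hy
          exact ⟨(y, g y), rfl, rfl, hy⟩
        · have := (mem_primal_carrier_iff x).1 hx.1.mem_carrier i
          rw [hg] at this
          exact_mod_cast this
      -- Strictness at the Slater point puts height `0` above the function value, so `(x, 0)` is a
      -- core point of the epigraph.
      · exact ⟨_, 0, hf _, subset_rfl, fun p hp => ⟨p, hp, rfl, le_rfl⟩,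
          isRelCore_epi (hf _) hcore (hx.1.strict i hlin), fun _ => le_rfl⟩
  choose S s hS hsub hlow hcore hs using key
  refine dual_exists_of_isRelCore hp hc hf hS hsub hlow (q₀ := fun i => (x, s i))
    (isRelCore_pi hS hcore) ?_ ?_ hval
  · ext1 i; simp [diffMap_apply]
  · intro i; rw [slackMap_apply]; exact hs _ (Fin.succ_ne_zero i)

end Strong

end

end ConvexDuality

open ConvexDuality in
theorem mainTheorem6 (d m : ℕ) (f : Fin (m + 1) → EuclideanSpace ℝ (Fin d) → EReal)
    (hproper : ∀ i, IsProper (f i)) (hclosed : ∀ i, IsClosedFun (f i))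
    (hconvex : ∀ i, IsConvexFun (f i)) :
    ((∃ x, (primal f).IsSlaterPoint x) →
        (primal f).value = (dual f).value ∧ (dual f).Solvable) ∧
    ((∃ z, (dual f).IsSlaterPoint z) →
        (primal f).value = (dual f).value ∧ (primal f).Solvable) ∧
    ((primal f).feasibleRegion.Nonempty ∧ Bornology.IsBounded (primal f).feasibleRegion →
        (primal f).value = (dual f).value ∧ (primal f).Solvable) ∧
    ((dual f).feasibleRegion.Nonempty ∧ Bornology.IsBounded (dual f).feasibleRegion →
        (primal f).value = (dual f).value ∧ (dual f).Solvable) := by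
  refine ⟨?_, ?_, ?_, ?_⟩
  · rintro ⟨x, hx⟩
    exact strong_duality_dual_solvable hproper hclosed hconvex
      ⟨x, hx.1.mem_carrier, (isRelCore_of_mem_intrinsicInterior hx.2).1⟩
      fun c hc => dual_exists_of_isSlaterPoint hproper hclosed hconvex hx hc
  · rintro ⟨z, hz⟩
    refine strong_duality_primal_solvable hproper hclosed hconvex
      (isRelCore_of_mem_intrinsicInterior hz.2) ?_
    rw [sumMap_apply]
    exact ((mem_dual_carrier_iff z).1 hz.1.mem_carrier).2
  · rintro ⟨hne, hbd⟩
    obtain ⟨z, hz, hsum⟩ :=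
      exists_isRelCore_of_isBounded_primal hproper hclosed hconvex hne hbd
    exact strong_duality_primal_solvable hproper hclosed hconvex hz hsum
  · rintro ⟨hne, hbd⟩
    obtain ⟨q, hq, hdiff, hslack⟩ :=
      exists_isRelCore_of_isBounded_dual hproper hclosed hconvex hne hbd
    -- The core point has equal `x`-components and zero constraint heights, so its objective
    -- component is itself primal feasible.
    refine strong_duality_dual_solvable hproper hclosed hconvex
      ⟨(q 0).1, (mem_primal_carrier_iff _).2 fun i => ?_,
        lt_of_le_of_lt (hq.1 0 trivial) (EReal.coe_lt_top _)⟩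
      fun c hc => dual_exists_of_isRelCore hproper hclosed hconvex hconvex
        (fun _ => subset_rfl) (fun _ p hp => ⟨p, hp, rfl, le_rfl⟩) hq hdiff
        (fun i => by rw [hslack]; exact le_rfl) hc
    have h1 : (q i.succ).1 = (q 0).1 := by
      have := congrFun hdiff i
      rwa [diffMap_apply, Pi.zero_apply, sub_eq_zero] at this
    have h2 : (q i.succ).2 = 0 := by
      have := congrFun hslack i
      rwa [slackMap_apply] at this
    have h3 : f i.succ (q i.succ).1 ≤ ((q i.succ).2 : EReal) := hq.1 i.succ trivial
    rwa [h1, h2] at h3
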